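/- Fix a real number $\theta>0$ and a positive integer $r$. There exists a constant $C_r$, depending only on $r$ and $\theta$, such that the following holds. Let $N\ge 1$, let $\mathbf i=(i_1,\dots,i_r)$ and $\mathbf s=(s_1,\dots,s_r)$ be any lists of elements of $[N]=\{1,\dots,N\}$, let $\tau=(\tau_1,\dots,\tau_\ell)$ be any set partition of $[r]$, and let $\sigma$ be an Ewens random permutation in $S_N$ with parameter $\theta$, i.e. $$\mathbb P(\sigma=\rho)=\frac{\theta^{\#(\rho)}}{\theta(\theta+1)\cdots(\theta+N-1)}\qquad(\rho\in S_N),$$ where $\#(\rho)$ is the number of cycles of $\rho$ (fixed points included). For $a,b\in[N]$ let $B^{(N)}_{a,b}$ be the indicator variable of the event $\sigma(a)=b$. Then $$\left|\kappa\left(\prod_{j\in\tau_1}B^{(N)}_{i_j,s_j},\dots,\prod_{j\in\tau_\ell}B^{(N)}_{i_j,s_j}\right)\right|\le C_r\,N^{-\#(\mathrm{Conn}(G_1))-\#(\mathrm{Conn}(G_2)\vee\tau)+1}.$$ Here: - $\kappa(X_1,\dots,X_\ell)=[t_1\cdots t_\ell]\,\ln\mathbb E\big(\exp(t_1X_1+\dots+t_\ell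 X_\ell)\big)$ is the joint cumulant, where $[t_1\cdots t_\ell]F$ is the coefficient of $t_1\cdots t_\ell$ in the power series expansion of $F$ at $0$; - $G_1=G_1(\mathbf i,\mathbf s)$ is the graph with vertex set $[r]$ in which distinct $j,h$ are linked if and only if $i_j=i_h$ and $s_j=s_h$; - $G_2=G_2(\mathbf i,\mathbf s)$ is the graph with vertex set $[r]$ in which distinct $j,h$ are linked if and only if $\{i_j,s_j\}\cap\{i_h,s_h\}\neq\emptyset$; - $\mathrm{Conn}(G)$ is the set partition of $[r]$ into the vertex sets of the connected components of $G$, $\#(\pi)$ is the number of parts of a set partition $\pi$, and $\pi\vee\pi'$ is the finest set partition that is coarser than both $\pi$ and $\pi'$. -/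

import Mathlib

open MeasureTheory

noncomputable section

/-- All subsets of the finite set `S_N` are measurable. -/
instance instMeasurableSpacePermFin (N : ℕ) : MeasurableSpace (Equiv.Perm (Fin N)) := ⊤

instance instDiscreteMeasurableSpacePermFin (N : ℕ) :
    DiscreteMeasurableSpace (Equiv.Perm (Fin N)) := ⟨fun _ => trivial⟩

/-- The number of cycles of a permutation, fixed points included. -/
def numCycles {N : ℕ} (σ : Equiv.Perm (Fin N)) : ℕ :=
  σ.partition.parts.card

/-- The Ewens measure with parameter `θ` on `S_N`: the permutation `σ` has mass
`θ ^ #(σ) / (θ (θ + 1) ⋯ (θ + N - 1))`. -/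
def ewensMeasure (θ : ℝ) (N : ℕ) : Measure (Equiv.Perm (Fin N)) :=
  ∑ σ : Equiv.Perm (Fin N),
    ENNReal.ofReal (θ ^ numCycles σ / ∏ k ∈ Finset.range N, (θ + k)) • Measure.dirac σ

/-- The joint cumulant `κ(X_1, …, X_ℓ)`: the coefficient of `t_1 ⋯ t_ℓ` in the expansion of
`ln E[exp(t_1 X_1 + ⋯ + t_ℓ X_ℓ)]` at `t = 0`, that is, the mixed partial derivative
`∂^ℓ / ∂t_1 ⋯ ∂t_ℓ` of this function at `0`. -/
def jointCumulant {Ω : Type*} [MeasurableSpace Ω] (P : Measure Ω) {ℓ : ℕ}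
    (X : Fin ℓ → Ω → ℝ) : ℝ :=
  iteratedFDeriv ℝ ℓ
    (fun t : Fin ℓ → ℝ => Real.log (∫ ω, Real.exp (∑ h, t h * X h ω) ∂P)) 0
    (fun h => Pi.single h 1)

/-- The elementary variable `B_{a,b}`, equal to `1` if `σ(a) = b` and to `0` otherwise. -/
def elemVar {Ω : Type*} {N : ℕ} (σ : Ω → Equiv.Perm (Fin N)) (a b : Fin N) (ω : Ω) : ℝ :=
  if σ ω a = b then 1 else 0

/-- The graph `G_1(i, s)` on `[r]`: distinct `j`, `h` are linked iff `i_j = i_h` and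
`s_j = s_h`. -/
def graphG1 {r N : ℕ} (i s : Fin r → Fin N) : SimpleGraph (Fin r) where
  Adj j h := j ≠ h ∧ i j = i h ∧ s j = s h
  symm := ⟨fun _ _ hjh => ⟨hjh.1.symm, hjh.2.1.symm, hjh.2.2.symm⟩⟩
  loopless := ⟨fun _ hj => hj.1 rfl⟩

/-- The graph `G_2(i, s)` on `[r]`: distinct `j`, `h` are linked iff
`{i_j, s_j} ∩ {i_h, s_h} ≠ ∅`. -/
def graphG2 {r N : ℕ} (i s : Fin r → Fin N) : SimpleGraph (Fin r) where
  Adj j h := j ≠ h ∧ (({i j, s j} : Set (Fin N)) ∩ {i h, s h}).Nonempty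
  symm := ⟨fun _ _ hjh => ⟨hjh.1.symm, by rw [Set.inter_comm]; exact hjh.2⟩⟩
  loopless := ⟨fun _ hj => hj.1 rfl⟩

/-- The equivalence relation "lying in the same part of `τ`". Through it, set partitions of `[r]`
are identified with equivalence relations on `[r]`; `≤` on `Setoid (Fin r)` is then the refinement
order (finer ≤ coarser) and `⊔` is the join of set partitions. -/
def partitionSetoid {r : ℕ} (τ : Finpartition (Finset.univ : Finset (Fin r))) :
    Setoid (Fin r) :=
  Setoid.ker τ.part

/-- The set partition `Conn(G)` into connected components, as an equivalence relation. -/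
def connSetoid {r : ℕ} (G : SimpleGraph (Fin r)) : Setoid (Fin r) :=
  G.reachableSetoid

/-- The number of parts of a set partition given as an equivalence relation. -/
def numParts {r : ℕ} (π : Setoid (Fin r)) : ℕ :=
  Nat.card (Quotient π)

end

/-! The pairs (i_j, s_j) attached to a set Δ of parts of τ form a relation on [N] with K(Δ) distinct
elements. The moment indexed by Δ is f(Δ) m_{K(Δ)}, where m_k = 1/((N+θ-1)⋯(N+θ-k)) and f is 0
unless the relation is a partial injection, in which case it is θ to the number of cycles closed
(`ewens_moment`, from `ewensSum_eq`). Group the parts of τ by the blocks of Conn(G_2) ∨ τ: distinct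
groups touch disjoint sets of points, so f is multiplicative and K additive over groups. Only m_k
fails to factor.

For large N, m_k is the k-th moment of the inverse of a gamma variable of shape N+θ. So write the
moments as φ(F), with F(Δ) = f(Δ) X^{K(Δ)} and φ(X^k) = m_k, in the ring of multilinear series in
the t_h. Now F factors over groups, so H = log F is carried by subsets of single groups
(`log_eq_zero`), and X^{K(B)} divides H(B) (`X_pow_dvd_log`).

The cumulant is the top coefficient of log φ(exp H), hence a sum of values of the tilted functional
p ↦ φ(pF)/φ(F) at coefficients of H. Integration by parts for φ shows that the coefficient at Δ of
the tilted X^k is O(N^{-k-K(Δ)-g(Δ)}), with g(Δ) the number of groups met by Δ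
(`tilted_X_pow_isBigO`). Splitting off one coefficient of H costs at most one group, which yields
the exponent K + g - 1 (`cumulant_isBigO`); on the full set, K and g are the two numbers of parts in
the statement.

The constant is uniform because only finitely many data (ℓ, grouping, f, K) occur for given r
(`cumulant_uniform_bound`). -/

/-- Multilinear formal series in variables indexed by `ι`: the coefficient of the monomial
`∏ h ∈ Δ, t_h` is the value at `Δ`, and squares of variables vanish. -/
def SetSeries (ι R : Type*) := Finset ι → R

/-! ### The ring of multilinear series: derivations and logarithms. -/

namespace SetSeries

set_option linter.unusedSectionVars false

variable {ι R : Type*} [DecidableEq ι] [CommRing R]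

@[ext] theorem ext {f g : SetSeries ι R} (h : ∀ Δ, f Δ = g Δ) : f = g := funext h

noncomputable instance : AddCommGroup (SetSeries ι R) :=
  inferInstanceAs (AddCommGroup (Finset ι → R))

instance : Mul (SetSeries ι R) := ⟨fun f g Δ => ∑ S ∈ Δ.powerset, f S * g (Δ \ S)⟩

instance : One (SetSeries ι R) := ⟨fun Δ => if Δ = ∅ then 1 else 0⟩

theorem add_apply (f g : SetSeries ι R) (Δ : Finset ι) : (f + g) Δ = f Δ + g Δ := rfl
theorem sub_apply (f g : SetSeries ι R) (Δ : Finset ι) : (f - g) Δ = f Δ - g Δ := rfl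
theorem zero_apply (Δ : Finset ι) : (0 : SetSeries ι R) Δ = 0 := rfl
theorem one_apply (Δ : Finset ι) : (1 : SetSeries ι R) Δ = if Δ = ∅ then 1 else 0 := rfl
theorem mul_apply (f g : SetSeries ι R) (Δ : Finset ι) :
    (f * g) Δ = ∑ S ∈ Δ.powerset, f S * g (Δ \ S) := rfl

protected theorem mul_comm (f g : SetSeries ι R) : f * g = g * f := by
  ext Δ
  rw [mul_apply, mul_apply]
  refine Finset.sum_bij' (fun S _ => Δ \ S) (fun S _ => Δ \ S) ?_ ?_ ?_ ?_ ?_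
  · intro S _; simp
  · intro S _; simp
  · intro S hS; simpa using hS
  · intro S hS; simpa using hS
  · intro S hS
    rw [Finset.mem_powerset] at hS
    simp only [Finset.sdiff_sdiff_eq_self hS]
    ring

protected theorem mul_assoc (f g h : SetSeries ι R) : f * g * h = f * (g * h) := by
  ext Δ
  simp only [mul_apply, Finset.sum_mul, Finset.mul_sum]
  rw [Finset.sum_sigma', Finset.sum_sigma']
  refine Finset.sum_bij' (fun p _ => ⟨p.2, p.1 \ p.2⟩) (fun p _ => ⟨p.1 ∪ p.2, p.1⟩)
    ?_ ?_ ?_ ?_ ?_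
  · rintro ⟨S, T⟩ hp
    simp only [Finset.mem_sigma, Finset.mem_powerset] at hp ⊢
    exact ⟨hp.2.trans hp.1, Finset.sdiff_subset_sdiff hp.1 le_rfl⟩
  · rintro ⟨S, T⟩ hp
    simp only [Finset.mem_sigma, Finset.mem_powerset] at hp ⊢
    exact ⟨Finset.union_subset hp.1 (hp.2.trans Finset.sdiff_subset), Finset.subset_union_left⟩
  · rintro ⟨S, T⟩ hp
    simp only [Finset.mem_sigma, Finset.mem_powerset] at hp
    simp [Finset.union_sdiff_of_subset hp.2]
  · rintro ⟨S, T⟩ hp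
    simp only [Finset.mem_sigma, Finset.mem_powerset] at hp
    have : Disjoint T S := (Finset.disjoint_sdiff.mono_right hp.2).symm
    simp [Finset.union_sdiff_left, this.sdiff_eq_left]
  · rintro ⟨S, T⟩ hp
    simp only [Finset.mem_sigma, Finset.mem_powerset] at hp
    have : (Δ \ T) \ (S \ T) = Δ \ S := by
      ext x
      simp only [Finset.mem_sdiff]
      have := @hp.2 x
      tauto
    simp only [this]
    ring

protected theorem one_mul (f : SetSeries ι R) : 1 * f = f := by
  ext Δ
  rw [mul_apply, Finset.sum_eq_single ∅]
  · simp [one_apply]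
  · intro S _ hS; simp [one_apply, hS]
  · simp

protected theorem mul_add (f g h : SetSeries ι R) : f * (g + h) = f * g + f * h := by
  ext Δ
  simp [mul_apply, add_apply, mul_add, Finset.sum_add_distrib]

noncomputable instance : CommRing (SetSeries ι R) :=
  { (inferInstance : AddCommGroup (SetSeries ι R)) with
    mul := (· * ·)
    one := 1
    mul_assoc := SetSeries.mul_assoc
    mul_comm := SetSeries.mul_comm
    one_mul := SetSeries.one_mul
    mul_one := fun f => by rw [SetSeries.mul_comm, SetSeries.one_mul]
    left_distrib := SetSeries.mul_add
    right_distrib := fun f g h => by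
      rw [SetSeries.mul_comm, SetSeries.mul_add, SetSeries.mul_comm h, SetSeries.mul_comm h]
    zero_mul := fun f => by ext Δ; simp [mul_apply, zero_apply]
    mul_zero := fun f => by ext Δ; simp [mul_apply, zero_apply] }

theorem mul_apply_empty (f g : SetSeries ι R) : (f * g) ∅ = f ∅ * g ∅ := by
  simp [mul_apply]

theorem sum_apply {κ : Type*} (s : Finset κ) (f : κ → SetSeries ι R) (Δ : Finset ι) :
    (∑ k ∈ s, f k) Δ = ∑ k ∈ s, f k Δ := by
  classical
  induction s using Finset.induction_on with
  | empty => simp [zero_apply]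
  | insert a s ha ih => rw [Finset.sum_insert ha, Finset.sum_insert ha, add_apply, ih]

theorem pow_apply_eq_zero {u : SetSeries ι R} (hu : u ∅ = 0) (n : ℕ) :
    ∀ Δ : Finset ι, Δ.card < n → (u ^ n) Δ = 0 := by
  induction n with
  | zero => intro Δ h; omega
  | succ n ih =>
    intro Δ h
    rw [pow_succ', mul_apply]
    refine Finset.sum_eq_zero fun S hS => ?_
    rw [Finset.mem_powerset] at hS
    rcases S.eq_empty_or_nonempty with rfl | hne
    · rw [hu, zero_mul]
    · rw [ih, mul_zero]
      have := Finset.card_sdiff_add_card_eq_card hS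
      have := hne.card_pos
      omega

/-- `1 - F` has no constant term, so its powers vanish on ever larger sets; as `ι` is finite, it is
nilpotent. -/
theorem isUnit_of_apply_empty [Fintype ι] {F : SetSeries ι R} (hF : F ∅ = 1) : IsUnit F := by
  have hn : IsNilpotent (1 - F) := by
    refine ⟨Fintype.card ι + 1, ?_⟩
    ext Δ
    refine pow_apply_eq_zero ?_ _ _ ?_
    · simp [sub_apply, one_apply, hF]
    · have := Finset.card_le_univ Δ
      omega
  simpa using hn.isUnit_one_sub

/-- Multiplication of the coefficients by a weight. -/
def weight (c : Finset ι → R) (f : SetSeries ι R) : SetSeries ι R := fun Δ => c Δ * f Δ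

theorem weight_apply (c : Finset ι → R) (f : SetSeries ι R) (Δ : Finset ι) :
    weight c f Δ = c Δ * f Δ := rfl

/-- Multiplication of the coefficients by an additive weight is a derivation. -/
theorem weight_mul (c : Finset ι → R) (hc : ∀ S Δ, S ⊆ Δ → c Δ = c S + c (Δ \ S))
    (f g : SetSeries ι R) : weight c (f * g) = weight c f * g + f * weight c g := by
  ext Δ
  rw [add_apply, weight_apply, mul_apply, mul_apply, mul_apply, Finset.mul_sum,
    ← Finset.sum_add_distrib]
  refine Finset.sum_congr rfl fun S hS => ?_
  rw [weight_apply, weight_apply, hc S Δ (Finset.mem_powerset.1 hS)]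
  ring

/-- The Euler operator `∑ h, t_h ∂_h`. -/
def euler (f : SetSeries ι R) : SetSeries ι R := fun Δ => (Δ.card : R) * f Δ

theorem euler_apply (f : SetSeries ι R) (Δ : Finset ι) : euler f Δ = (Δ.card : R) * f Δ := rfl

theorem euler_mul (f g : SetSeries ι R) : euler (f * g) = euler f * g + f * euler g :=
  weight_mul (fun Δ => (Δ.card : R)) (fun S Δ h => by
    rw [← Finset.card_sdiff_add_card_eq_card h]; push_cast; ring) f g

theorem euler_add (f g : SetSeries ι R) : euler (f + g) = euler f + euler g := by
  ext Δ; simp only [euler_apply, add_apply]; ring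

/-- The operator `t_a ∂_a`. -/
def part (a : ι) (f : SetSeries ι R) : SetSeries ι R := fun Δ => (if a ∈ Δ then 1 else 0) * f Δ

theorem part_apply (a : ι) (f : SetSeries ι R) (Δ : Finset ι) :
    part a f Δ = (if a ∈ Δ then 1 else 0) * f Δ := rfl

theorem part_mul (a : ι) (f g : SetSeries ι R) :
    part a (f * g) = part a f * g + f * part a g :=
  weight_mul (fun Δ => if a ∈ Δ then 1 else 0) (fun S Δ h => by
    have := @h a
    by_cases h1 : a ∈ S <;> by_cases h2 : a ∈ Δ <;> simp_all) f g

/-- The coefficientwise action of a derivation of the coefficient ring. -/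
def mapDer {A : Type*} [CommRing A] [Algebra A R] (d : Derivation A R R) (f : SetSeries ι R) :
    SetSeries ι R :=
  fun Δ => d (f Δ)

theorem mapDer_mul {A : Type*} [CommRing A] [Algebra A R] (d : Derivation A R R)
    (f g : SetSeries ι R) : mapDer d (f * g) = mapDer d f * g + f * mapDer d g := by
  ext Δ
  rw [add_apply, mul_apply, mul_apply, mapDer, mul_apply, map_sum, ← Finset.sum_add_distrib]
  refine Finset.sum_congr rfl fun S _ => ?_
  simp only [mapDer, Derivation.leibniz, smul_eq_mul]
  ring

/-- The logarithm is obtained from its differential equation: `euler` multiplies the coefficient at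
`Δ` by `Δ.card`, so it can be inverted away from `∅`, and `H` is the preimage of `F⁻¹ * euler F`. -/
theorem exists_log [Fintype ι] [Algebra ℚ R] {F : SetSeries ι R} (hF : F ∅ = 1) :
    ∃ H : SetSeries ι R, H ∅ = 0 ∧ euler F = F * euler H := by
  obtain ⟨u, hu⟩ := isUnit_of_apply_empty hF
  obtain ⟨G, hG⟩ : ∃ G, G = (↑u⁻¹ : SetSeries ι R) * euler F := ⟨_, rfl⟩
  obtain ⟨H, hH⟩ : ∃ H : SetSeries ι R, ∀ Δ, H Δ = ((Δ.card : ℚ)⁻¹) • G Δ := ⟨fun Δ => _, fun _ => rfl⟩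
  have key : euler H = G := by
    ext Δ
    rw [euler_apply, hH]
    rcases Δ.eq_empty_or_nonempty with rfl | hne
    · simp [hG, mul_apply_empty, euler_apply]
    · have : (Δ.card : ℚ) ≠ 0 := by simpa using hne.ne_empty
      rw [← nsmul_eq_mul, ← Nat.cast_smul_eq_nsmul ℚ, smul_smul, mul_inv_cancel₀ this, one_smul]
  refine ⟨H, by simp [hH], ?_⟩
  rw [key, hG, ← mul_assoc, ← hu, Units.mul_inv, one_mul]

/-- A derivation commuting with the Euler operator sees `F = exp H`. -/
theorem log_deriv [Fintype ι] [CharZero R] [NoZeroDivisors R] {F H : SetSeries ι R}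
    (hF : F ∅ = 1) (h : euler F = F * euler H) (d : SetSeries ι R → SetSeries ι R)
    (hmul : ∀ f g, d (f * g) = d f * g + f * d g) (hcomm : ∀ f, d (euler f) = euler (d f))
    (hdF : d F ∅ = 0) (hdH : d H ∅ = 0) : d F = F * d H := by
  obtain ⟨u, hu⟩ := isUnit_of_apply_empty hF
  -- `Z` is the defect of the identity. Computing `euler (d F)` in two ways gives `euler Z = 0`, so
  -- only the constant term of `Z` could survive, and it vanishes too.
  obtain ⟨Z, hZ⟩ : ∃ Z, d F = F * (d H + Z) :=
    ⟨↑u⁻¹ * d F - d H, by rw [add_sub_cancel, ← mul_assoc, ← hu, Units.mul_inv, one_mul]⟩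
  have h1 : euler (d F) = F * euler H * (d H + Z) + F * (euler (d H) + euler Z) := by
    rw [hZ, euler_mul, h, euler_add]
  have h2 : euler (d F) = F * (d H + Z) * euler H + F * euler (d H) := by
    rw [← hcomm, h, hmul, hcomm, ← hZ]
  have h3 : F * euler Z = 0 := by linear_combination h2 - h1
  have h4 : euler Z = 0 := by
    rw [← hu] at h3
    exact (Units.mul_right_eq_zero u).1 h3
  have h5 : Z = 0 := by
    ext Δ
    rcases Δ.eq_empty_or_nonempty with rfl | hne
    · have := congrFun hZ ∅
      rw [mul_apply_empty, hdF, hF, one_mul, add_apply, hdH, zero_add] at this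
      exact this.symm
    · have := congrFun h4 Δ
      rw [euler_apply] at this
      rcases mul_eq_zero.1 this with h | h
      · rw [Nat.cast_eq_zero, Finset.card_eq_zero] at h
        exact absurd h hne.ne_empty
      · exact h
  rw [hZ, h5, add_zero]

theorem part_log [Fintype ι] [CharZero R] [NoZeroDivisors R] {F H : SetSeries ι R}
    (hF : F ∅ = 1) (h : euler F = F * euler H) (a : ι) : part a F = F * part a H := by
  refine log_deriv hF h _ (part_mul a) (fun f => ?_) (by simp [part_apply]) (by simp [part_apply])
  ext Δ
  simp only [part_apply, euler_apply]
  ring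

theorem mapDer_log [Fintype ι] [CharZero R] [NoZeroDivisors R] {A : Type*} [CommRing A]
    [Algebra A R] {F H : SetSeries ι R} (hF : F ∅ = 1) (hH : H ∅ = 0)
    (h : euler F = F * euler H) (d : Derivation A R R) : mapDer d F = F * mapDer d H := by
  refine log_deriv hF h _ (mapDer_mul d) (fun f => ?_) (by simp [mapDer, hF])
    (by simp [mapDer, hH])
  ext Δ
  simp [mapDer, euler_apply]

/-- The logarithm of a series which factors over the fibres of `comp` is carried by subsets of
fibres. -/
theorem log_eq_zero [Fintype ι] [CharZero R] [NoZeroDivisors R] {β : Type*} [DecidableEq β]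
    {F H : SetSeries ι R} (comp : ι → β) (hF : F ∅ = 1) (h : euler F = F * euler H)
    (hfac : ∀ (d : β) (Δ : Finset ι),
      F Δ = F (Δ.filter (comp · = d)) * F (Δ.filter (comp · ≠ d)))
    (a b : ι) (hab : comp a ≠ comp b) (n : ℕ) :
    ∀ Δ : Finset ι, Δ.card = n → a ∈ Δ → b ∈ Δ → H Δ = 0 := by
  induction n using Nat.strong_induction_on generalizing b with
  | _ n ih =>
  intro Δ hn ha hb
  have hp := part_log hF h a
  have h1 : ∀ Γ : Finset ι, a ∈ Γ → F Γ = ∑ S ∈ Γ.powerset, part a H S * F (Γ \ S) := by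
    intro Γ hΓ
    have := congrFun hp Γ
    rw [mul_comm, mul_apply, part_apply, if_pos hΓ, one_mul] at this
    exact this
  -- In the expansion of `part a F` at `Δ`, a proper subset containing `a` and leaving the fibre `Γ`
  -- contributes zero by induction. There remain `S = Δ`, worth `H Δ`, and `S ⊆ Γ`, whose terms add
  -- up to `F Γ * F (Δ \ Γ) = F Δ`.
  set Γ := Δ.filter (comp · = comp a) with hΓ
  have hΓΔ : Γ ⊆ Δ := Finset.filter_subset _ _
  have haΓ : a ∈ Γ := by simp [hΓ, ha]
  have hbΓ : b ∉ Γ := by simp [hΓ, hab.symm]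
  have h2 : F Δ = H Δ + ∑ S ∈ Γ.powerset, part a H S * F (Δ \ S) := by
    rw [h1 Δ ha]
    rw [← Finset.sum_subset (s₁ := insert Δ Γ.powerset)]
    · rw [Finset.sum_insert]
      · rw [part_apply, if_pos ha, sdiff_self, Finset.bot_eq_empty, hF]
        ring
      · rw [Finset.mem_powerset]
        exact fun hc => hbΓ (hc hb)
    · intro S hS
      rw [Finset.mem_insert, Finset.mem_powerset] at hS
      rw [Finset.mem_powerset]
      rcases hS with rfl | hS
      · exact le_rfl
      · exact hS.trans hΓΔ
    · intro S hS hS'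
      rw [Finset.mem_insert, Finset.mem_powerset, not_or] at hS'
      rw [Finset.mem_powerset] at hS
      rw [part_apply]
      by_cases haS : a ∈ S
      · obtain ⟨c, hcS, hc⟩ := Finset.not_subset.1 hS'.2
        rw [ih S.card (hn ▸ Finset.card_lt_card (lt_of_le_of_ne hS hS'.1)) c ?_ S rfl haS hcS]
        · ring
        · intro hac
          exact hc (by simp [hΓ, hS hcS, hac])
      · simp [haS]
  have h3 : ∑ S ∈ Γ.powerset, part a H S * F (Δ \ S) =
      (∑ S ∈ Γ.powerset, part a H S * F (Γ \ S)) * F (Δ.filter (comp · ≠ comp a)) := by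
    rw [Finset.sum_mul]
    refine Finset.sum_congr rfl fun S hS => ?_
    rw [Finset.mem_powerset] at hS
    rw [hfac (comp a) (Δ \ S)]
    have e1 : (Δ \ S).filter (comp · = comp a) = Γ \ S := by
      ext x; simp [hΓ]; tauto
    have e2 : (Δ \ S).filter (comp · ≠ comp a) = Δ.filter (comp · ≠ comp a) := by
      ext x
      have := @hS x
      simp [hΓ] at this ⊢
      tauto
    rw [e1, e2]
    ring
  rw [h3, ← h1 Γ haΓ, ← hfac (comp a) Δ] at h2
  simpa using h2

end SetSeries

/-! ### Linear maps acting on coefficients. -/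

namespace SetSeries

variable {ι R S : Type*} [DecidableEq ι] [CommRing R] [CommRing S]

set_option linter.unusedSectionVars false

/-- The coefficientwise action of a linear map. -/
def mapLin {A : Type*} [CommRing A] [Algebra A R] [Algebra A S] (φ : R →ₗ[A] S)
    (f : SetSeries ι R) : SetSeries ι S :=
  fun Δ => φ (f Δ)

theorem mapLin_apply {A : Type*} [CommRing A] [Algebra A R] [Algebra A S] (φ : R →ₗ[A] S)
    (f : SetSeries ι R) (Δ : Finset ι) : mapLin φ f Δ = φ (f Δ) := rfl

/-- The monomial `∏ h ∈ B, t_h`. -/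
def monom (B : Finset ι) : SetSeries ι R := fun Δ => if Δ = B then 1 else 0

theorem monom_apply (B Δ : Finset ι) : (monom B : SetSeries ι R) Δ = if Δ = B then 1 else 0 := rfl

theorem monom_mul_apply (B Δ : Finset ι) (f : SetSeries ι R) :
    ((monom B : SetSeries ι R) * f) Δ = if B ⊆ Δ then f (Δ \ B) else 0 := by
  rw [mul_apply]
  simp only [monom_apply, ite_mul, one_mul, zero_mul]
  rw [Finset.sum_ite_eq']
  simp

/-- `φ` is linear but not multiplicative: expanding only `H` into monomials leaves `φ` applied to
multiples of `F`. -/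
theorem mapLin_mul [Fintype ι] {A : Type*} [CommRing A] [Algebra A R] [Algebra A S]
    (φ : R →ₗ[A] S) (q : R) (F H : SetSeries ι R) :
    mapLin φ (weight (fun _ => q) (F * H)) =
      ∑ B, monom B * mapLin φ (weight (fun _ => q * H B) F) := by
  ext Δ
  rw [sum_apply]
  simp only [monom_mul_apply]
  rw [← Finset.sum_filter, mapLin_apply, weight_apply, mul_comm F H, mul_apply, Finset.mul_sum,
    map_sum]
  refine Finset.sum_congr ?_ fun B _ => ?_
  · ext B; simp
  · rw [mapLin_apply, weight_apply, mul_assoc]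

end SetSeries

/-! ### Inverse moments and integration by parts. -/

section Asymptotics

open Polynomial Filter Asymptotics

/-- The inverse moment `1 / ((N + θ - 1) (N + θ - 2) ⋯ (N + θ - k))`. -/
noncomputable def inverseMoment (θ : ℝ) (N k : ℕ) : ℝ :=
  ∏ i ∈ Finset.range k, ((N : ℝ) + θ - (i + 1))⁻¹

theorem inverseMoment_zero (θ : ℝ) (N : ℕ) : inverseMoment θ N 0 = 1 := by
  simp [inverseMoment]

theorem inverseMoment_succ (θ : ℝ) (N k : ℕ) :
    inverseMoment θ N (k + 1) = inverseMoment θ N k * ((N : ℝ) + θ - (k + 1))⁻¹ :=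
  Finset.prod_range_succ _ _

theorem eventually_shift_pos (θ c : ℝ) : ∀ᶠ N : ℕ in atTop, (N : ℝ) / 2 + 1 ≤ (N : ℝ) + θ - c := by
  filter_upwards [tendsto_natCast_atTop_atTop.eventually_ge_atTop (2 * (c + 1 - θ))] with N hN
  linarith

theorem inv_shift_isBigO (θ c : ℝ) :
    (fun N : ℕ => ((N : ℝ) + θ - c)⁻¹) =O[atTop] fun N : ℕ => (N : ℝ)⁻¹ := by
  refine IsBigO.of_bound 2 ?_
  filter_upwards [eventually_shift_pos θ c, eventually_ge_atTop 1] with N hN h1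
  have h1' : (1 : ℝ) ≤ N := by exact_mod_cast h1
  rw [Real.norm_of_nonneg (by rw [inv_nonneg]; linarith), Real.norm_of_nonneg (by positivity),
    ← div_eq_mul_inv, inv_eq_one_div, div_le_div_iff₀ (by linarith) (by linarith)]
  linarith

theorem inverseMoment_isBigO (θ : ℝ) (k : ℕ) :
    (fun N : ℕ => inverseMoment θ N k) =O[atTop] fun N : ℕ => ((N : ℝ)⁻¹) ^ k := by
  induction k with
  | zero => simpa [inverseMoment_zero] using isBigO_refl (fun _ : ℕ => (1 : ℝ)) atTop
  | succ k ih =>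
    simp only [inverseMoment_succ, pow_succ]
    exact ih.mul (inv_shift_isBigO θ _)

theorem inv_pow_isBigO {m n : ℕ} (h : m ≤ n) :
    (fun N : ℕ => ((N : ℝ)⁻¹) ^ n) =O[atTop] fun N : ℕ => ((N : ℝ)⁻¹) ^ m := by
  refine IsBigO.of_bound 1 ?_
  filter_upwards [eventually_ge_atTop 1] with N h1
  have h1' : (1 : ℝ) ≤ N := by exact_mod_cast h1
  rw [Real.norm_of_nonneg (by positivity), Real.norm_of_nonneg (by positivity), one_mul]
  exact pow_le_pow_of_le_one (by positivity) (inv_le_one_of_one_le₀ h1') h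

/-- The linear functional sending `X ^ k` to the `k`-th inverse moment. -/
noncomputable def inverseFunctional (θ : ℝ) (N : ℕ) : ℝ[X] →ₗ[ℝ] ℝ :=
  lsum fun k => inverseMoment θ N k • LinearMap.id

theorem inverseFunctional_monomial (θ : ℝ) (N k : ℕ) (c : ℝ) :
    inverseFunctional θ N (monomial k c) = inverseMoment θ N k * c := by
  simp [inverseFunctional, sum_monomial_index]

theorem inverseFunctional_X_pow (θ : ℝ) (N k : ℕ) :
    inverseFunctional θ N (X ^ k) = inverseMoment θ N k := by
  rw [← monomial_one_right_eq_X_pow, inverseFunctional_monomial, mul_one]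

/-- Integration by parts for the inverse moments. -/
theorem inverseFunctional_parts (θ : ℝ) (q : ℝ[X]) :
    ∀ᶠ N : ℕ in atTop, ((N : ℝ) + θ) * inverseFunctional θ N (X * q) =
      inverseFunctional θ N q + inverseFunctional θ N (X * derivative (X * q)) := by
  induction q using Polynomial.induction_on' with
  | add p q hp hq =>
    filter_upwards [hp, hq] with N h1 h2
    simp only [mul_add, map_add]
    linear_combination h1 + h2
  | monomial k c =>
    -- On `X ^ k` the identity is the recursion `(N + θ - (k + 1)) m_{k+1} = m_k`, which fails if
    -- that factor is zero; hence `N` large.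
    filter_upwards [eventually_shift_pos θ (k + 1)] with N hN
    have h0 : (N : ℝ) + θ - (k + 1) ≠ 0 := by
      have : (0 : ℝ) ≤ N := Nat.cast_nonneg N
      intro h
      linarith
    have hs : inverseMoment θ N (k + 1) * ((N : ℝ) + θ - (k + 1)) = inverseMoment θ N k := by
      rw [inverseMoment_succ, mul_assoc, inv_mul_cancel₀ h0, mul_one]
    rw [X_mul_monomial, derivative_monomial, X_mul_monomial]
    simp only [inverseFunctional_monomial, Nat.add_sub_cancel]
    push_cast
    linear_combination c * hs

/-- The derivation `X d/dX`. -/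
noncomputable def eulerDerivation : Derivation ℝ ℝ[X] ℝ[X] := (X : ℝ[X]) • derivative'

theorem eulerDerivation_apply (p : ℝ[X]) : eulerDerivation p = X * derivative p := rfl

theorem X_pow_dvd_eulerDerivation {j : ℕ} {p : ℝ[X]} (h : X ^ j ∣ p) :
    X ^ j ∣ eulerDerivation p := by
  obtain ⟨q, rfl⟩ := h
  rw [eulerDerivation_apply, derivative_mul, derivative_X_pow]
  rcases j with - | j
  · simp
  · refine ⟨C ((j + 1 : ℕ) : ℝ) * q + X * derivative q, ?_⟩
    rw [Nat.add_sub_cancel]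
    ring

/-! ### The tilted functional and the order of cumulants. -/

namespace SetSeries

set_option linter.unusedSectionVars false

variable {ι : Type*} [DecidableEq ι] [Fintype ι]

/-- The expectation of the polynomial `p` for the functional `inverseFunctional θ N` tilted by
the density `F`; here `G` stands for the inverse of the total mass. -/
noncomputable def tilted (θ : ℝ) (F : SetSeries ι ℝ[X]) (G : ℕ → SetSeries ι ℝ) (N : ℕ)
    (p : ℝ[X]) : SetSeries ι ℝ :=
  mapLin (inverseFunctional θ N) (weight (fun _ => p) F) * G N

variable {θ : ℝ} {F H : SetSeries ι ℝ[X]} {G : ℕ → SetSeries ι ℝ}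

theorem tilted_add (N : ℕ) (p q : ℝ[X]) :
    tilted θ F G N (p + q) = tilted θ F G N p + tilted θ F G N q := by
  rw [tilted, tilted, tilted, ← add_mul]
  congr 1
  ext Δ
  simp [mapLin_apply, weight_apply, add_apply, add_mul]

theorem tilted_smul_apply (N : ℕ) (c : ℝ) (p : ℝ[X]) (Δ : Finset ι) :
    tilted θ F G N (c • p) Δ = c * tilted θ F G N p Δ := by
  rw [tilted, tilted, mul_apply, mul_apply, Finset.mul_sum]
  refine Finset.sum_congr rfl fun S _ => ?_
  rw [mapLin_apply, mapLin_apply, weight_apply, weight_apply, smul_mul_assoc, map_smul,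
    smul_eq_mul]
  ring

theorem tilted_zero (N : ℕ) : tilted θ F G N 0 = 0 := by
  have := tilted_add (θ := θ) (F := F) (G := G) N 0 0
  simpa using this

theorem tilted_mul (N : ℕ) (q : ℝ[X]) (Δ : Finset ι) :
    (mapLin (inverseFunctional θ N) (weight (fun _ => q) (F * H)) * G N) Δ =
      ∑ B ∈ Δ.powerset, tilted θ F G N (q * H B) (Δ \ B) := by
  rw [mapLin_mul, Finset.sum_mul, sum_apply]
  simp only [mul_assoc, monom_mul_apply]
  rw [← Finset.sum_filter]
  refine Finset.sum_congr ?_ fun B _ => rfl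
  ext B; simp

theorem tilted_one (hG : ∀ N, mapLin (inverseFunctional θ N) F * G N = 1) (N : ℕ) :
    tilted θ F G N 1 = 1 := by
  rw [← hG N, tilted]
  congr 1
  ext Δ
  simp [mapLin_apply, weight_apply]

/-- By linearity, the lowest power of `X` allowed by divisibility sets the order. -/
theorem tilted_isBigO_of_dvd {Δ : Finset ι} {c j : ℕ} {p : ℝ[X]}
    (h : ∀ k, (fun N => tilted θ F G N (X ^ k) Δ) =O[atTop] fun N : ℕ => ((N : ℝ)⁻¹) ^ (k + c))
    (hp : X ^ j ∣ p) :
    (fun N => tilted θ F G N p Δ) =O[atTop] fun N : ℕ => ((N : ℝ)⁻¹) ^ (j + c) := by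
  obtain ⟨q, rfl⟩ := hp
  induction q using Polynomial.induction_on' with
  | add p q hp hq => simpa only [mul_add, tilted_add, add_apply] using hp.add hq
  | monomial n a =>
    have : (X : ℝ[X]) ^ j * monomial n a = a • X ^ (j + n) := by
      rw [← C_mul_X_pow_eq_monomial, smul_eq_C_mul]; ring
    simp only [this, tilted_smul_apply]
    exact ((h (j + n)).trans (inv_pow_isBigO (by omega))).const_mul_left a

/-- Each component of `comp` met by `Δ` contributes a factor `1 / N`. -/
theorem tilted_X_pow_isBigO {β : Type*} [DecidableEq β] (comp : ι → β) (K : Finset ι → ℕ)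
    (hK0 : K ∅ = 0) (hK : ∀ S Δ, S ⊆ Δ → K Δ ≤ K S + K (Δ \ S))
    (hF : F ∅ = 1) (hH0 : H ∅ = 0) (hFH : mapDer eulerDerivation F = F * mapDer eulerDerivation H)
    (hcomp : ∀ B, ∀ a ∈ B, ∀ b ∈ B, comp a ≠ comp b → H B = 0) (hdvd : ∀ B, X ^ K B ∣ H B)
    (hG : ∀ N, mapLin (inverseFunctional θ N) F * G N = 1) (n : ℕ) :
    ∀ Δ : Finset ι, Δ.card = n → ∀ k, (fun N => tilted θ F G N (X ^ k) Δ) =O[atTop]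
      fun N : ℕ => ((N : ℝ)⁻¹) ^ (k + (K Δ + (Δ.image comp).card)) := by
  induction n using Nat.strong_induction_on with
  | _ n ih =>
  intro Δ hn k
  rcases Δ.eq_empty_or_nonempty with rfl | hne
  · have hG0 : ∀ N, G N ∅ = 1 := by
      intro N
      have := congrFun (hG N) ∅
      rw [mul_apply_empty, mapLin_apply, hF, ← pow_zero X, inverseFunctional_X_pow,
        inverseMoment_zero, one_mul] at this
      simpa [one_apply] using this
    have : (fun N => tilted θ F G N (X ^ k) ∅) = fun N => inverseMoment θ N k := by
      funext N
      rw [tilted, mul_apply_empty, hG0, mul_one, mapLin_apply, weight_apply, hF, mul_one,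
        inverseFunctional_X_pow]
    rw [this]
    simpa [hK0] using inverseMoment_isBigO θ k
  · induction k with
    | zero =>
      -- The tilted functional maps `1` to the series `1`, which has no coefficient on nonempty
      -- sets. This cancellation starts the recursion and is the source of the gain.
      have : (fun N => tilted θ F G N (X ^ 0) Δ) = fun _ => 0 := by
        funext N
        rw [pow_zero, tilted_one hG, one_apply, if_neg hne.ne_empty]
      rw [this]
      exact isBigO_zero _ _
    | succ k ihk =>
      -- Integration by parts against `X ^ k * F`, using `X dF/dX = F * X dH/dX`; the term from
      -- differentiating `X ^ (k + 1)` is moved to the left.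
      have hev : ∀ᶠ N : ℕ in atTop, ((N : ℝ) + θ - (k + 1)) * tilted θ F G N (X ^ (k + 1)) Δ =
          tilted θ F G N (X ^ k) Δ +
          ∑ B ∈ Δ.powerset, tilted θ F G N (X ^ (k + 1) * mapDer eulerDerivation H B) (Δ \ B) := by
        have h1 : ∀ᶠ N : ℕ in atTop, ∀ S : Finset ι,
            ((N : ℝ) + θ) * inverseFunctional θ N (X * (X ^ k * F S)) =
            inverseFunctional θ N (X ^ k * F S) +
            inverseFunctional θ N (X * derivative (X * (X ^ k * F S))) :=
          eventually_all.2 fun S => inverseFunctional_parts θ _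
        filter_upwards [h1] with N hN
        rw [← tilted_mul, ← hFH, tilted, tilted, mul_apply, mul_apply, mul_apply, Finset.mul_sum,
          ← Finset.sum_add_distrib]
        refine Finset.sum_congr rfl fun S _ => ?_
        simp only [mapLin_apply, weight_apply, mapDer, eulerDerivation_apply]
        have e : (X : ℝ[X]) * derivative (X * (X ^ k * F S)) =
            ((k : ℝ) + 1) • (X ^ (k + 1) * F S) + X ^ (k + 1) * (X * derivative (F S)) := by
          rw [← mul_assoc X, ← pow_succ', derivative_mul, derivative_X_pow, Nat.add_sub_cancel,
            smul_eq_C_mul]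
          simp only [Nat.cast_add, Nat.cast_one, map_add, map_one]
          ring
        have := hN S
        rw [e, map_add, map_smul, ← mul_assoc X, ← pow_succ', smul_eq_mul] at this
        linear_combination (G N (Δ \ S)) * this
      have hsum : (fun N : ℕ => tilted θ F G N (X ^ k) Δ +
          ∑ B ∈ Δ.powerset, tilted θ F G N (X ^ (k + 1) * mapDer eulerDerivation H B) (Δ \ B))
          =O[atTop] fun N : ℕ => ((N : ℝ)⁻¹) ^ (k + (K Δ + (Δ.image comp).card)) := by
        refine ihk.add (IsBigO.fun_sum fun B hB => ?_)
        rw [Finset.mem_powerset] at hB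
        by_cases hz : H B = 0
        · simp only [mapDer, hz, map_zero, mul_zero, tilted_zero, zero_apply]
          exact isBigO_zero _ _
        have hBne : B.Nonempty := by
          rw [Finset.nonempty_iff_ne_empty]
          rintro rfl
          exact hz hH0
        obtain ⟨b, hb⟩ := hBne
        have hcard : (Δ \ B).card < n := by
          rw [← hn]
          exact Finset.card_lt_card (Finset.sdiff_ssubset hB ⟨b, hb⟩)
        -- A nonzero `H B` lives in one fibre, so deleting `B` loses at most one fibre; the
        -- additional factor `X` in `X ^ (k + 1)` pays for it.
        have himg : (Δ.image comp).card ≤ ((Δ \ B).image comp).card + 1 := by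
          refine (Finset.card_le_card ?_).trans (Finset.card_insert_le (comp b) _)
          intro x hx
          obtain ⟨y, hy, rfl⟩ := Finset.mem_image.1 hx
          rw [Finset.mem_insert]
          by_cases hyB : y ∈ B
          · left
            by_contra hc
            exact hz (hcomp B y hyB b hb hc)
          · exact Or.inr (Finset.mem_image_of_mem _ (Finset.mem_sdiff.2 ⟨hy, hyB⟩))
        refine (tilted_isBigO_of_dvd (j := k + 1 + K B) (ih _ hcard _ rfl) ?_).trans
          (inv_pow_isBigO ?_)
        · rw [pow_add]
          exact mul_dvd_mul_left _ (X_pow_dvd_eulerDerivation (hdvd B))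
        · have := hK B Δ hB
          omega
      have := (inv_shift_isBigO θ (k + 1)).mul hsum
      refine (IsBigO.congr' this ?_ ?_)
      · filter_upwards [hev, eventually_shift_pos θ (k + 1)] with N hN hpos
        have : (0 : ℝ) ≤ N := Nat.cast_nonneg N
        rw [← hN, ← mul_assoc, inv_mul_cancel₀ (by intro h; linarith), one_mul]
      · filter_upwards with N
        ring

/-- `F B` is `H B` plus products `H S * F (B \ S)` over proper subsets `S` containing a fixed `a`.
Subadditivity of `K` makes each product divisible by `X ^ K B`. -/
theorem X_pow_dvd_log (K : Finset ι → ℕ) (hK0 : K ∅ = 0)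
    (hK : ∀ S Δ, S ⊆ Δ → K Δ ≤ K S + K (Δ \ S)) (hF : F ∅ = 1)
    (hFH : euler F = F * euler H) (hdvd : ∀ B, X ^ K B ∣ F B) (n : ℕ) :
    ∀ B : Finset ι, B.card = n → X ^ K B ∣ H B := by
  induction n using Nat.strong_induction_on with
  | _ n ih =>
  intro B hn
  rcases B.eq_empty_or_nonempty with rfl | ⟨a, ha⟩
  · simp [hK0]
  have h1 := congrFun (part_log hF hFH a) B
  rw [mul_comm, mul_apply, part_apply, if_pos ha, one_mul,
    ← Finset.sum_erase_add _ _ (Finset.mem_powerset_self B), sdiff_self, Finset.bot_eq_empty, hF,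
    part_apply, if_pos ha, one_mul, mul_one] at h1
  rw [← sub_eq_iff_eq_add'] at h1
  rw [← h1]
  refine dvd_sub (hdvd B) (Finset.dvd_sum fun S hS => ?_)
  rw [Finset.mem_erase, Finset.mem_powerset] at hS
  have h2 := ih S.card (hn ▸ Finset.card_lt_card (lt_of_le_of_ne hS.2 hS.1)) S rfl
  refine (pow_dvd_pow X (hK S B hS.2)).trans ?_
  rw [pow_add]
  exact mul_dvd_mul (h2.mul_left _) (hdvd _)

/-- Quasi-factorization: if the moments are `f Δ` times the inverse moment of order `K Δ`, where
`f` is multiplicative and `K` additive over the fibres of `comp`, then the cumulant gains a factor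
`1 / N` for each fibre but one. -/
theorem cumulant_isBigO {β : Type*} [DecidableEq β] (θ : ℝ) (comp : ι → β) (f : Finset ι → ℝ)
    (K : Finset ι → ℕ) (hf0 : f ∅ = 1) (hK0 : K ∅ = 0)
    (hK : ∀ S Δ, S ⊆ Δ → K Δ ≤ K S + K (Δ \ S))
    (hfmul : ∀ (d : β) (Δ : Finset ι),
      f Δ = f (Δ.filter (comp · = d)) * f (Δ.filter (comp · ≠ d)))
    (hKadd : ∀ (d : β) (Δ : Finset ι),
      K Δ = K (Δ.filter (comp · = d)) + K (Δ.filter (comp · ≠ d)))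
    (a : ι) (M κ : ℕ → SetSeries ι ℝ) (hM : ∀ N Δ, M N Δ = f Δ * inverseMoment θ N (K Δ))
    (hκ : ∀ N, part a (M N) = M N * part a (κ N)) :
    (fun N => κ N Finset.univ) =O[atTop]
      fun N : ℕ => ((N : ℝ)⁻¹) ^ (K Finset.univ + ((Finset.univ.image comp).card - 1)) := by
  obtain ⟨F, hFdef⟩ : ∃ F : SetSeries ι ℝ[X], ∀ Δ, F Δ = monomial (K Δ) (f Δ) :=
    ⟨fun Δ => _, fun _ => rfl⟩
  have hF : F ∅ = 1 := by rw [hFdef, hf0, hK0, monomial_zero_one]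
  have hFfac : ∀ (d : β) (Δ : Finset ι),
      F Δ = F (Δ.filter (comp · = d)) * F (Δ.filter (comp · ≠ d)) := by
    intro d Δ
    rw [hFdef, hFdef, hFdef, monomial_mul_monomial, ← hKadd, ← hfmul]
  obtain ⟨H, hH0, hFH⟩ := exists_log hF
  have hcomp : ∀ B, ∀ a ∈ B, ∀ b ∈ B, comp a ≠ comp b → H B = 0 := fun B a ha b hb hab =>
    log_eq_zero comp hF hFH hFfac a b hab _ B rfl ha hb
  have hdvd : ∀ B, X ^ K B ∣ H B := fun B =>
    X_pow_dvd_log K hK0 hK hF hFH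
      (fun B => by rw [hFdef, ← C_mul_X_pow_eq_monomial]; exact Dvd.intro_left _ rfl) _ B rfl
  have hMF : ∀ N, M N = mapLin (inverseFunctional θ N) F := by
    intro N
    ext Δ
    rw [hM, mapLin_apply, hFdef, inverseFunctional_monomial, mul_comm]
  have hM0 : ∀ N, M N ∅ = 1 := by
    intro N
    rw [hM, hf0, hK0, inverseMoment_zero, one_mul]
  choose u hu using fun N => isUnit_of_apply_empty (hM0 N)
  obtain ⟨G, hGdef⟩ : ∃ G : ℕ → SetSeries ι ℝ, ∀ N, G N = ↑(u N)⁻¹ := ⟨fun N => _, fun _ => rfl⟩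
  have hMG : ∀ N, M N * G N = 1 := fun N => by rw [hGdef, ← hu, Units.mul_inv]
  have hG : ∀ N, mapLin (inverseFunctional θ N) F * G N = 1 := fun N => by rw [← hMF, hMG]
  have hbound := tilted_X_pow_isBigO (G := G) comp K hK0 hK hF hH0
    (mapDer_log hF hH0 hFH eulerDerivation) hcomp hdvd hG
  -- This is `t_a ∂_a log φ(F) = φ(F * t_a ∂_a H) / φ(F)`, read at the full set.
  have hκ' : ∀ N, κ N Finset.univ =
      ∑ B ∈ (Finset.univ : Finset ι).powerset, tilted θ F G N (part a H B) (Finset.univ \ B) := by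
    intro N
    have h1 : part a (κ N) = part a (M N) * G N := by
      rw [hκ, mul_right_comm, hMG, one_mul]
    have h2 : part a (M N) =
        mapLin (inverseFunctional θ N) (weight (fun _ => 1) (F * part a H)) := by
      rw [← part_log hF hFH, hMF]
      ext Δ
      simp only [part_apply, mapLin_apply, weight_apply]
      split_ifs <;> simp
    have h3 := congrFun h1 Finset.univ
    rw [h2, tilted_mul, part_apply, if_pos (Finset.mem_univ a), one_mul] at h3
    simpa only [one_mul] using h3
  simp only [hκ']
  refine IsBigO.fun_sum fun B _ => ?_
  by_cases hz : part a H B = 0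
  · simp only [hz, tilted_zero, zero_apply]
    exact isBigO_zero _ _
  have haB : a ∈ B := by
    by_contra hc
    simp [part_apply, hc] at hz
  have hHB : part a H B = H B := by rw [part_apply, if_pos haB, one_mul]
  rw [hHB] at hz ⊢
  -- Here no extra power of `X` compensates for the lost fibre: hence the `- 1` in the exponent.
  have himg : ((Finset.univ : Finset ι).image comp).card ≤
      ((Finset.univ \ B).image comp).card + 1 := by
    refine (Finset.card_le_card ?_).trans (Finset.card_insert_le (comp a) _)
    intro x hx
    obtain ⟨y, hy, rfl⟩ := Finset.mem_image.1 hx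
    rw [Finset.mem_insert]
    by_cases hyB : y ∈ B
    · left
      by_contra hc
      exact hz (hcomp B y hyB a haB hc)
    · exact Or.inr (Finset.mem_image_of_mem _ (Finset.mem_sdiff.2 ⟨hy, hyB⟩))
  refine (tilted_isBigO_of_dvd (hbound _ _ rfl) (hdvd B)).trans (inv_pow_isBigO ?_)
  have := hK B Finset.univ (Finset.subset_univ B)
  omega

end SetSeries

end Asymptotics

/-! ### Mixed partial derivatives and analytic cumulants. -/

section Partials

open scoped ContDiff

set_option linter.unusedSectionVars false

variable {ι : Type*} [Fintype ι] [DecidableEq ι]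

/-- The partial derivative in the direction of the `a`-th coordinate. -/
noncomputable def partialDeriv (a : ι) (f : (ι → ℝ) → ℝ) : (ι → ℝ) → ℝ :=
  fun x => fderiv ℝ f x (Pi.single a 1)

theorem ContDiff.partialDeriv {f : (ι → ℝ) → ℝ} (hf : ContDiff ℝ ∞ f) (a : ι) :
    ContDiff ℝ ∞ (partialDeriv a f) :=
  (hf.fderiv_right (m := ∞) (by simp)).clm_apply contDiff_const

theorem partialDeriv_comm {f : (ι → ℝ) → ℝ} (hf : ContDiff ℝ ∞ f) (a b : ι) :
    partialDeriv a (partialDeriv b f) = partialDeriv b (partialDeriv a f) := by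
  funext x
  have hd : Differentiable ℝ (fderiv ℝ f) :=
    (hf.fderiv_right (m := ∞) (by simp)).differentiable (by simp)
  have h : ∀ c d : ι, partialDeriv c (partialDeriv d f) x =
      fderiv ℝ (fderiv ℝ f) x (Pi.single c 1) (Pi.single d 1) := by
    intro c d
    unfold partialDeriv
    rw [fderiv_clm_apply (hd x) (by fun_prop)]
    simp
  rw [h, h]
  refine (hf.contDiffAt.isSymmSndFDerivAt ?_) _ _
  rw [minSmoothness_of_isRCLikeNormedField]
  exact WithTop.coe_le_coe.2 (le_top : (2 : ℕ∞) ≤ ⊤)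

theorem partialDeriv_mul {f g : (ι → ℝ) → ℝ} (hf : ContDiff ℝ ∞ f) (hg : ContDiff ℝ ∞ g) (a : ι) :
    partialDeriv a (f * g) = partialDeriv a f * g + f * partialDeriv a g := by
  funext x
  have h1 : DifferentiableAt ℝ f x := hf.differentiable (by simp) x
  have h2 : DifferentiableAt ℝ g x := hg.differentiable (by simp) x
  rw [partialDeriv, fderiv_mul h1 h2]
  simp [partialDeriv]
  ring

theorem partialDeriv_sum {κ : Type*} (s : Finset κ) {f : κ → (ι → ℝ) → ℝ}
    (hf : ∀ k, ContDiff ℝ ∞ (f k)) (a : ι) :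
    partialDeriv a (∑ k ∈ s, f k) = ∑ k ∈ s, partialDeriv a (f k) := by
  funext x
  rw [partialDeriv, fderiv_sum fun k _ => (hf k).differentiable (by simp) x]
  simp [partialDeriv]

/-- Iterated partial derivatives, the head of the list being the outermost derivative. -/
noncomputable def listDeriv (l : List ι) (f : (ι → ℝ) → ℝ) : (ι → ℝ) → ℝ :=
  l.foldr partialDeriv f

theorem ContDiff.listDeriv {f : (ι → ℝ) → ℝ} (hf : ContDiff ℝ ∞ f) (l : List ι) :
    ContDiff ℝ ∞ (listDeriv l f) := by
  induction l with
  | nil => exact hf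
  | cons a l ih => exact ih.partialDeriv a

theorem listDeriv_perm {f : (ι → ℝ) → ℝ} (hf : ContDiff ℝ ∞ f) {l l' : List ι} (h : l.Perm l') :
    listDeriv l f = listDeriv l' f := by
  induction h with
  | nil => rfl
  | cons a _ ih => exact congrArg (partialDeriv a) ih
  | swap a b l => exact partialDeriv_comm (hf.listDeriv l) b a
  | trans _ _ h1 h2 => exact h1.trans h2

/-- The mixed partial derivative with respect to all variables in `Δ`. -/
noncomputable def setDeriv (Δ : Finset ι) (f : (ι → ℝ) → ℝ) : (ι → ℝ) → ℝ :=
  listDeriv Δ.toList f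

theorem ContDiff.setDeriv {f : (ι → ℝ) → ℝ} (hf : ContDiff ℝ ∞ f) (Δ : Finset ι) :
    ContDiff ℝ ∞ (setDeriv Δ f) :=
  hf.listDeriv _

theorem setDeriv_empty (f : (ι → ℝ) → ℝ) : setDeriv ∅ f = f := by
  simp [setDeriv, listDeriv]

theorem setDeriv_insert {f : (ι → ℝ) → ℝ} (hf : ContDiff ℝ ∞ f) {a : ι} {Δ : Finset ι}
    (ha : a ∉ Δ) : setDeriv (insert a Δ) f = partialDeriv a (setDeriv Δ f) :=
  listDeriv_perm hf (Finset.toList_insert ha)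

/-- Taking the derivative along `a` innermost allows a formula for `partialDeriv a f` to be
substituted. -/
theorem setDeriv_insert' {f : (ι → ℝ) → ℝ} (hf : ContDiff ℝ ∞ f) {a : ι} {Δ : Finset ι}
    (ha : a ∉ Δ) : setDeriv (insert a Δ) f = setDeriv Δ (partialDeriv a f) := by
  rw [setDeriv, listDeriv_perm hf ((Finset.toList_insert ha).trans
    (List.perm_append_singleton a Δ.toList).symm)]
  simp [setDeriv, listDeriv]

theorem setDeriv_mul {f g : (ι → ℝ) → ℝ} (hf : ContDiff ℝ ∞ f) (hg : ContDiff ℝ ∞ g)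
    (Δ : Finset ι) :
    setDeriv Δ (f * g) = ∑ S ∈ Δ.powerset, setDeriv S f * setDeriv (Δ \ S) g := by
  induction Δ using Finset.induction_on with
  | empty => simp [setDeriv_empty]
  | insert a Δ ha ih =>
    rw [setDeriv_insert (f := f * g) (hf.mul hg) ha, ih,
      partialDeriv_sum (f := fun S => setDeriv S f * setDeriv (Δ \ S) g) _ fun S => (hf.setDeriv S).mul (hg.setDeriv _),
      Finset.sum_powerset_insert ha, ← Finset.sum_add_distrib]
    refine Finset.sum_congr rfl fun S hS => ?_
    rw [Finset.mem_powerset] at hS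
    have haS : a ∉ S := fun h => ha (hS h)
    rw [partialDeriv_mul (hf.setDeriv S) (hg.setDeriv _), setDeriv_insert hf haS,
      Finset.insert_sdiff_of_notMem _ haS, setDeriv_insert hg (by simp [ha]),
      Finset.insert_sdiff_insert, Finset.sdiff_insert_of_notMem ha, add_comm]

/-- The multilinear part of the Taylor expansion at `0`. -/
noncomputable def jet (f : (ι → ℝ) → ℝ) : SetSeries ι ℝ := fun Δ => setDeriv Δ f 0

/-- This is `∂_a F = (∂_a log F) F`, differentiated by the Leibniz rule. It is the only link needed
between analytic cumulants and formal logarithms. -/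
theorem part_jet_of_log {F : (ι → ℝ) → ℝ} (hF : ContDiff ℝ ∞ F) (hpos : ∀ x, 0 < F x) (a : ι) :
    SetSeries.part a (jet F) =
      jet F * SetSeries.part a (jet fun x => Real.log (F x)) := by
  have hW : ContDiff ℝ ∞ fun x => Real.log (F x) := hF.log fun x => (hpos x).ne'
  have hd : partialDeriv a F = partialDeriv a (fun x => Real.log (F x)) * F := by
    funext x
    have h1 : DifferentiableAt ℝ F x := hF.differentiable (by simp) x
    rw [Pi.mul_apply, partialDeriv, partialDeriv, fderiv.log h1 (hpos x).ne']
    have := (hpos x).ne'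
    simp
    field_simp
  ext Δ
  rw [mul_comm, SetSeries.part_apply, SetSeries.mul_apply]
  by_cases ha : a ∈ Δ
  · rw [if_pos ha, one_mul]
    obtain ⟨Γ, haΓ, rfl⟩ : ∃ Γ, a ∉ Γ ∧ insert a Γ = Δ :=
      ⟨Δ.erase a, by simp, Finset.insert_erase ha⟩
    rw [Finset.sum_powerset_insert haΓ]
    have h0 : ∀ S ∈ Γ.powerset, SetSeries.part a (jet fun x => Real.log (F x)) S *
        jet F (insert a Γ \ S) = 0 := by
      intro S hS
      rw [SetSeries.part_apply, if_neg fun h => haΓ (Finset.mem_powerset.1 hS h)]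
      ring
    rw [Finset.sum_eq_zero h0, zero_add]
    have h1 : jet F (insert a Γ) =
        (∑ S ∈ Γ.powerset, setDeriv S (partialDeriv a fun x => Real.log (F x)) *
          setDeriv (Γ \ S) F) 0 := by
      rw [jet, setDeriv_insert' hF haΓ, hd, setDeriv_mul (hW.partialDeriv a) hF]
    rw [h1, Finset.sum_apply]
    refine Finset.sum_congr rfl fun S hS => ?_
    have haS : a ∉ S := fun h => haΓ (Finset.mem_powerset.1 hS h)
    rw [SetSeries.part_apply, if_pos (Finset.mem_insert_self a S), one_mul, jet,
      setDeriv_insert' hW haS, jet, Finset.insert_sdiff_insert,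
      Finset.sdiff_insert_of_notMem haΓ, Pi.mul_apply]
  · rw [if_neg ha, zero_mul, Finset.sum_eq_zero]
    intro S hS
    rw [SetSeries.part_apply, if_neg fun h => ha (Finset.mem_powerset.1 hS h)]
    ring

theorem iteratedFDeriv_single {f : (ι → ℝ) → ℝ} (hf : ContDiff ℝ ∞ f) (n : ℕ) (m : Fin n → ι)
    (x : ι → ℝ) : iteratedFDeriv ℝ n f x (fun h => Pi.single (m h) 1) =
      listDeriv (List.ofFn m) f x := by
  induction n generalizing x with
  | zero => simp [listDeriv]
  | succ n ih =>
    have hd : DifferentiableAt ℝ (iteratedFDeriv ℝ n f) x :=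
      hf.differentiable_iteratedFDeriv (by exact_mod_cast WithTop.coe_lt_top n) x
    rw [iteratedFDeriv_succ_apply_left, ← fderiv_continuousMultilinear_apply_const_apply hd,
      List.ofFn_succ]
    change _ = fderiv ℝ (listDeriv (List.ofFn fun i => m i.succ) f) x (Pi.single (m 0) 1)
    congr 2
    funext y
    exact ih (fun i => m i.succ) y

theorem jet_univ {ℓ : ℕ} {f : (Fin ℓ → ℝ) → ℝ} (hf : ContDiff ℝ ∞ f) :
    jet f Finset.univ = iteratedFDeriv ℝ ℓ f 0 (fun h => Pi.single h 1) := by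
  refine Eq.trans ?_ (iteratedFDeriv_single hf ℓ id 0).symm
  rw [jet, setDeriv]
  refine congrFun (listDeriv_perm hf ?_) 0
  rw [List.ofFn_id]
  refine (List.perm_ext_iff_of_nodup (Finset.nodup_toList _) (List.nodup_finRange ℓ)).2 ?_
  simp

/-- The moment generating function of finitely many weighted atoms. -/
noncomputable def expSum {α : Type*} [Fintype α] (w : α → ℝ) (X : ι → α → ℝ) (t : ι → ℝ) : ℝ :=
  ∑ p, w p * Real.exp (∑ h, t h * X h p)

theorem contDiff_expSum {α : Type*} [Fintype α] (w : α → ℝ) (X : ι → α → ℝ) :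
    ContDiff ℝ ∞ (expSum w X) := by
  unfold expSum
  fun_prop

theorem partialDeriv_expSum {α : Type*} [Fintype α] (w : α → ℝ) (X : ι → α → ℝ) (a : ι) :
    partialDeriv a (expSum w X) = expSum (fun p => w p * X a p) X := by
  funext t
  have h : HasFDerivAt (expSum w X) (∑ p, w p • (Real.exp (∑ h, t h * X h p) •
      ∑ h, X h p • (ContinuousLinearMap.proj h : (ι → ℝ) →L[ℝ] ℝ))) t := by
    unfold expSum
    refine HasFDerivAt.fun_sum fun p _ => ?_
    refine HasFDerivAt.const_mul (HasFDerivAt.exp (HasFDerivAt.fun_sum fun h _ => ?_)) _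
    exact (hasFDerivAt_apply h t).mul_const _
  rw [partialDeriv, h.fderiv]
  simp only [expSum, sum_apply, smul_apply,
    ContinuousLinearMap.proj_apply, smul_eq_mul, Pi.single_apply]
  refine Finset.sum_congr rfl fun p _ => ?_
  simp
  ring

theorem jet_expSum {α : Type*} [Fintype α] (w : α → ℝ) (X : ι → α → ℝ) (Δ : Finset ι) :
    jet (expSum w X) Δ = ∑ p, w p * ∏ h ∈ Δ, X h p := by
  rw [jet]
  have : setDeriv Δ (expSum w X) = expSum (fun p => w p * ∏ h ∈ Δ, X h p) X := by
    induction Δ using Finset.induction_on with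
    | empty => simp [setDeriv_empty]
    | insert a Δ ha ih =>
      rw [setDeriv_insert (contDiff_expSum w X) ha, ih, partialDeriv_expSum]
      congr 1
      funext p
      rw [Finset.prod_insert ha]
      ring
  rw [this]
  simp [expSum]

end Partials

/-! ### Ewens weights of partial injections. -/

section Ewens

open Equiv

/-- The number of orbits of a permutation. -/
noncomputable def orbitCount {α : Type*} (σ : Perm α) : ℕ :=
  Nat.card (Quotient (Perm.SameCycle.setoid σ))

theorem sameCycle_lift {α γ : Type*} {σ : Perm α} (f : α → γ) (h : ∀ x, f (σ x) = f x) {x y : α}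
    (hxy : σ.SameCycle x y) : f x = f y := by
  obtain ⟨n, rfl⟩ := hxy
  have hn : ∀ (n : ℕ) (z : α), f ((σ ^ n) z) = f z := by
    intro n
    induction n with
    | zero => simp
    | succ n ih => intro z; rw [pow_succ, Perm.mul_apply, ih, h]
  rcases n with n | n
  · simp [hn]
  · rw [← hn (n + 1) ((σ ^ (Int.negSucc n)) x)]
    simp [zpow_negSucc]

/-- `Φ` labels a fixed point by itself and any other point by its cycle: its fibres are the orbits,
its image the fixed points and cycle factors. -/
theorem card_parts_partition {α : Type*} [Fintype α] [DecidableEq α] (σ : Perm α) :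
    σ.partition.parts.card = orbitCount σ := by
  classical
  let Φ : α → Perm α ⊕ α := fun x => if σ x = x then Sum.inr x else Sum.inl (σ.cycleOf x)
  have hΦ : ∀ x y, Φ x = Φ y ↔ σ.SameCycle x y := by
    intro x y
    by_cases hx : σ x = x <;> by_cases hy : σ y = y <;> simp only [Φ, hx, hy, if_true, if_false]
    · rw [Sum.inr.injEq]
      exact ⟨fun h => h ▸ Perm.SameCycle.refl _ _, fun h => h.eq_of_left hx⟩
    · simp only [reduceCtorEq, false_iff]
      exact fun h => hy ((h.eq_of_left hx) ▸ hx)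
    · simp only [reduceCtorEq, false_iff]
      exact fun h => hx ((h.eq_of_right hy) ▸ hy)
    · rw [Sum.inl.injEq]
      exact (Perm.sameCycle_iff_cycleOf_eq_of_mem_support (Perm.mem_support.2 hx)
        (Perm.mem_support.2 hy)).symm
  have h1 : orbitCount σ = (Finset.univ.image Φ).card := by
    have hs : Perm.SameCycle.setoid σ = Setoid.ker Φ := by
      ext x y
      exact (hΦ x y).symm
    rw [orbitCount, hs, Nat.card_congr (Setoid.quotientKerEquivRange Φ), Nat.card_eq_fintype_card,
      ← Set.toFinset_card, Set.toFinset_range]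
  have h2 : Finset.univ.image Φ = σ.cycleFactorsFinset.disjSum σ.supportᶜ := by
    ext z
    simp only [Finset.mem_image, Finset.mem_univ, true_and, Finset.mem_disjSum]
    constructor
    · rintro ⟨x, rfl⟩
      by_cases hx : σ x = x
      · right
        exact ⟨x, by simpa using hx, by simp [Φ, hx]⟩
      · left
        exact ⟨σ.cycleOf x, Perm.cycleOf_mem_cycleFactorsFinset_iff.2 (Perm.mem_support.2 hx),
          by simp [Φ, hx]⟩
    · rintro (⟨c, hc, rfl⟩ | ⟨x, hx, rfl⟩)
      · obtain ⟨x, hx⟩ := (Perm.mem_cycleFactorsFinset_iff.1 hc).1.nonempty_support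
        refine ⟨x, ?_⟩
        have hxσ : σ x ≠ x :=
          Perm.mem_support.1 (Perm.mem_cycleFactorsFinset_support_le hc hx)
        simp only [Φ, hxσ, if_false]
        rw [Perm.cycle_is_cycleOf hx hc]
      · exact ⟨x, by simpa [Φ] using hx⟩
  rw [h1, h2, Finset.card_disjSum, Perm.parts_partition, Multiset.card_add,
    Multiset.card_replicate, Finset.card_compl, Perm.cycleType_def, Multiset.card_map]
  rfl

theorem orbitCount_permCongr {α γ : Type*} (e : α ≃ γ) (σ : Perm α) :
    orbitCount (e.permCongr σ) = orbitCount σ := by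
  refine (Nat.card_congr (Quotient.congr e fun x y => ?_)).symm
  constructor
  · intro h
    exact Quotient.exact (sameCycle_lift
      (fun x => (Quotient.mk (Perm.SameCycle.setoid (e.permCongr σ)) (e x)))
      (fun x => Quotient.sound (s := Perm.SameCycle.setoid (e.permCongr σ)) (by
        have : e (σ x) = e.permCongr σ (e x) := by simp
        rw [this]
        exact Perm.sameCycle_apply_left.2 (Perm.SameCycle.refl _ _))) h)
  · intro h
    have := sameCycle_lift
      (fun x => (Quotient.mk (Perm.SameCycle.setoid σ) (e.symm x)))
      (fun x => Quotient.sound (s := Perm.SameCycle.setoid σ) (by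
        have : e.symm (e.permCongr σ x) = σ (e.symm x) := by simp
        rw [this]
        exact Perm.sameCycle_apply_left.2 (Perm.SameCycle.refl _ _))) h
    simp only [symm_apply_apply] at this
    exact Quotient.exact this

/-- Deleting `none` from its cycle destroys an orbit only if `none` is fixed; otherwise `none`
belongs to the orbit of its image. -/
theorem orbitCount_decomposeOption {β : Type*} [Finite β] [DecidableEq β] (i : Option β)
    (σ : Perm β) :
    orbitCount (Perm.decomposeOption.symm (i, σ)) = orbitCount σ + if i = none then 1 else 0 := by
  set τ := Perm.decomposeOption.symm (i, σ) with hτ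
  have hnone : τ none = i := by simp [hτ]
  have hsome : ∀ x, some (σ x) ≠ i → τ (some x) = some (σ x) := by
    intro x hx
    simp only [hτ, Perm.decomposeOption_symm_apply, Perm.mul_apply, optionCongr_apply,
      Option.map_some]
    exact swap_apply_of_ne_of_ne (by simp) hx
  have hsome' : ∀ x, some (σ x) = i → τ (some x) = none := by
    intro x hx
    simp [hτ, hx]
  have hstep : ∀ (ρ : Perm (Option β)) x,
      Quotient.mk (Perm.SameCycle.setoid ρ) (ρ x) = Quotient.mk (Perm.SameCycle.setoid ρ) x :=
    fun ρ x => Quotient.sound (s := Perm.SameCycle.setoid ρ)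
      (Perm.sameCycle_apply_left.2 (Perm.SameCycle.refl _ _))
  have hstep' : ∀ x,
      Quotient.mk (Perm.SameCycle.setoid σ) (σ x) = Quotient.mk (Perm.SameCycle.setoid σ) x :=
    fun x => Quotient.sound (s := Perm.SameCycle.setoid σ)
      (Perm.sameCycle_apply_left.2 (Perm.SameCycle.refl _ _))
  have hfwd : ∀ x y, σ.SameCycle x y →
      Quotient.mk (Perm.SameCycle.setoid τ) (some x) =
      Quotient.mk (Perm.SameCycle.setoid τ) (some y) := by
    intro x y h
    refine sameCycle_lift (fun x => Quotient.mk (Perm.SameCycle.setoid τ) (some x)) ?_ h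
    intro x
    by_cases hx : some (σ x) = i
    · show Quotient.mk _ (some (σ x)) = Quotient.mk _ (some x)
      rw [← hstep τ (some x), hsome' x hx, ← hstep τ none, hnone, hx]
    · show Quotient.mk _ (some (σ x)) = Quotient.mk _ (some x)
      rw [← hstep τ (some x), hsome x hx]
  rcases i with - | b
  · rw [if_pos rfl, orbitCount, orbitCount, ← Finite.card_option]
    refine Nat.card_congr
      { toFun := Quotient.lift
          (fun z : Option β => z.map (Quotient.mk (Perm.SameCycle.setoid σ))) ?_
        invFun := fun q => q.elim (Quotient.mk (Perm.SameCycle.setoid τ) none)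
          (Quotient.lift (fun x => Quotient.mk (Perm.SameCycle.setoid τ) (some x)) hfwd)
        left_inv := ?_
        right_inv := ?_ }
    · intro x y h
      refine sameCycle_lift _ ?_ h
      rintro (- | x)
      · rw [hnone]
      · rw [hsome x (by simp), Option.map_some, Option.map_some, hstep']
    · intro q
      induction q using Quotient.inductionOn with
      | _ z => rcases z with - | z <;> rfl
    · rintro (- | q)
      · rfl
      · induction q using Quotient.inductionOn with
        | _ z => rfl
  · rw [if_neg (by simp), add_zero, orbitCount, orbitCount]
    refine Nat.card_congr
      { toFun := Quotient.lift
          (fun z : Option β => Quotient.mk (Perm.SameCycle.setoid σ) (z.getD b)) ?_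
        invFun :=
          (Quotient.lift (fun x => Quotient.mk (Perm.SameCycle.setoid τ) (some x)) hfwd)
        left_inv := ?_
        right_inv := ?_ }
    · intro x y h
      refine sameCycle_lift
        (fun z : Option β => Quotient.mk (Perm.SameCycle.setoid σ) (z.getD b)) ?_ h
      rintro (- | x)
      · rw [hnone]; rfl
      · by_cases hx : some (σ x) = some b
        · rw [hsome' x hx, ← Option.some.inj hx]
          exact hstep' x
        · rw [hsome x hx]
          exact hstep' x
    · intro q
      induction q using Quotient.inductionOn with
      | _ z =>
        rcases z with - | z
        · show Quotient.mk _ (some b) = Quotient.mk _ none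
          rw [← hnone, hstep]
        · rfl
    · intro q
      induction q using Quotient.inductionOn with
      | _ z => rfl

/-- The total weight of the permutations sending `p.1` to `p.2` for all `p` in the list. -/
noncomputable def ewensSum {α : Type*} [Fintype α] [DecidableEq α] (θ : ℝ) (l : List (α × α)) : ℝ :=
  ∑ σ : Perm α, if ∀ p ∈ l, σ p.1 = p.2 then θ ^ orbitCount σ else 0

theorem ewensSum_map {α γ : Type*} [Fintype α] [DecidableEq α] [Fintype γ] [DecidableEq γ] (θ : ℝ)
    (e : α ≃ γ) (l : List (α × α)) : ewensSum θ (l.map (Prod.map e e)) = ewensSum θ l := by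
  refine (Fintype.sum_equiv e.permCongr _ _ fun σ => ?_).symm
  rw [orbitCount_permCongr]
  congr 1
  rw [List.forall_mem_map]
  simp

/-- The number of cycles closed by a partial injection given by a list of pairs: contract the
pairs one after the other. -/
def closedCycles {α : Type*} [DecidableEq α] : List (α × α) → ℕ
  | [] => 0
  -- Contracting `p` deletes the point `p.1`: a loop is a closed cycle, and arrows into `p.1` are
  -- redirected to `p.2`.
  | p :: l => (if p.2 = p.1 then 1 else 0) +
      closedCycles (l.map fun q => (q.1, if q.2 = p.1 then p.2 else q.2))
termination_by l => l.length

theorem closedCycles_nil {α : Type*} [DecidableEq α] : closedCycles ([] : List (α × α)) = 0 := by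
  rw [closedCycles]

theorem closedCycles_cons {α : Type*} [DecidableEq α] (p : α × α) (l : List (α × α)) :
    closedCycles (p :: l) = (if p.2 = p.1 then 1 else 0) +
      closedCycles (l.map fun q => (q.1, if q.2 = p.1 then p.2 else q.2)) := by
  rw [closedCycles]

theorem closedCycles_map {α γ : Type*} [DecidableEq α] [DecidableEq γ] (f : α → γ)
    (hf : Function.Injective f) (n : ℕ) : ∀ l : List (α × α), l.length = n →
    closedCycles (l.map (Prod.map f f)) = closedCycles l := by
  induction n with
  | zero =>
    intro l hl
    rw [List.length_eq_zero_iff.1 hl, List.map_nil, closedCycles_nil, closedCycles_nil]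
  | succ n ih =>
    rintro (- | ⟨p, l⟩) hl
    · simp at hl
    · rw [List.map_cons, closedCycles_cons, closedCycles_cons, ← ih _ (by simpa using hl)]
      simp only [Prod.map_fst, Prod.map_snd, hf.eq_iff, List.map_map]
      congr 2
      refine List.map_congr_left fun q _ => ?_
      simp only [Function.comp_apply, Prod.map_fst, Prod.map_snd, hf.eq_iff, Prod.map_apply]
      split_ifs <;> rfl

theorem closedCycles_le {α : Type*} [DecidableEq α] (n : ℕ) : ∀ l : List (α × α), l.length = n →
    closedCycles l ≤ n := by
  induction n with
  | zero =>
    intro l hl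
    rw [List.length_eq_zero_iff.1 hl, closedCycles_nil]
  | succ n ih =>
    rintro (- | ⟨p, l⟩) hl
    · simp at hl
    · rw [closedCycles_cons]
      have := ih (l.map fun q => (q.1, if q.2 = p.1 then p.2 else q.2)) (by simpa using hl)
      split_ifs at * <;> omega

theorem closedCycles_append {α : Type*} [DecidableEq α] (l' : List (α × α)) (n : ℕ) :
    ∀ l : List (α × α), l.length = n →
    (∀ p ∈ l, ∀ q ∈ l', p.1 ≠ q.1 ∧ p.1 ≠ q.2 ∧ p.2 ≠ q.1 ∧ p.2 ≠ q.2) →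
    closedCycles (l ++ l') = closedCycles l + closedCycles l' := by
  induction n with
  | zero =>
    intro l hl _
    rw [List.length_eq_zero_iff.1 hl, closedCycles_nil, List.nil_append, zero_add]
  | succ n ih =>
    rintro (- | ⟨p, l⟩) hl h
    · simp at hl
    · rw [List.cons_append, closedCycles_cons, closedCycles_cons, List.map_append, add_assoc]
      have h1 : (l'.map fun q => (q.1, if q.2 = p.1 then p.2 else q.2)) = l' := by
        refine (List.map_congr_left fun q hq => ?_).trans (List.map_id _)
        rw [if_neg (h p List.mem_cons_self q hq).2.1.symm]
        rfl
      rw [h1, ih _ (by simpa using hl)]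
      intro q hq q' hq'
      obtain ⟨z, hz, rfl⟩ := List.mem_map.1 hq
      have hz' := h z (List.mem_cons_of_mem _ hz) q' hq'
      have hp' := h p List.mem_cons_self q' hq'
      split_ifs <;> simp_all

/-- The constraint at `none` fixes the first component of the decomposition. In the remaining
permutation of `β`, what was sent to `none` goes to `b`. -/
theorem ewensSum_decomposeOption {β : Type*} [Fintype β] [DecidableEq β] (θ : ℝ) (b : Option β)
    (l : List (Option β × Option β)) (l' : List (β × β))
    (h2 : ((none, b) :: l).map Prod.snd |>.Nodup)
    (hl' : (l.map fun q => (q.1, if q.2 = none then b else q.2)) =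
      l'.map (Prod.map some some)) :
    ewensSum θ ((none, b) :: l) = (if b = none then θ else 1) * ewensSum θ l' := by
  rw [ewensSum, ← Perm.decomposeOption.symm.sum_comp, Fintype.sum_prod_type,
    Finset.sum_eq_single b]
  · rw [ewensSum, Finset.mul_sum]
    refine Finset.sum_congr rfl fun σ _ => ?_
    rw [orbitCount_decomposeOption]
    have hiff : (∀ p ∈ (none, b) :: l, Perm.decomposeOption.symm (b, σ) p.1 = p.2) ↔
        ∀ p ∈ l', σ p.1 = p.2 := by
      have e1 : (∀ p ∈ l', σ p.1 = p.2) ↔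
          ∀ p ∈ l'.map (Prod.map some some), optionCongr σ p.1 = p.2 := by
        rw [List.forall_mem_map]
        simp
      rw [e1, ← hl', List.forall_mem_cons, List.forall_mem_map]
      have e2 : Perm.decomposeOption.symm (b, σ) none = b := by simp
      simp only [e2, true_and]
      refine forall₂_congr fun p hp => ?_
      have hpb : p.2 ≠ b := by
        intro h
        rw [List.map_cons, List.nodup_cons] at h2
        exact h2.1 (List.mem_map.2 ⟨p, hp, h⟩)
      simp only [Perm.decomposeOption_symm_apply, Perm.mul_apply]
      rw [swap_apply_eq_iff]
      by_cases hpn : p.2 = none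
      · rw [if_pos hpn, hpn, swap_apply_left]
      · rw [if_neg hpn, swap_apply_of_ne_of_ne hpn hpb]
    by_cases hσ : ∀ p ∈ l', σ p.1 = p.2
    · rw [if_pos (hiff.2 hσ), if_pos hσ]
      by_cases hb : b = none <;> simp [hb, pow_succ']
    · rw [if_neg (fun h => hσ (hiff.1 h)), if_neg hσ, mul_zero]
  · intro c _ hc
    refine Finset.sum_eq_zero fun σ _ => if_neg fun h => hc ?_
    have := h _ List.mem_cons_self
    simpa using this
  · simp

/-- Chinese restaurant step: `none` is a new fixed point, with weight `θ`, or is inserted before one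
of the elements of `β`. -/
theorem ewensSum_nil_option {β : Type*} [Fintype β] [DecidableEq β] (θ : ℝ) :
    ewensSum θ ([] : List (Option β × Option β)) =
      (θ + Fintype.card β) * ewensSum θ ([] : List (β × β)) := by
  rw [ewensSum, ← Perm.decomposeOption.symm.sum_comp, Fintype.sum_prod_type, Fintype.sum_option]
  simp only [orbitCount_decomposeOption, ewensSum]
  simp [pow_succ', ← Finset.mul_sum, add_mul]

/-- The Ewens weight of a partial injection. -/
theorem ewensSum_eq (θ : ℝ) (n : ℕ) : ∀ (α : Type) [Fintype α] [DecidableEq α]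
    (_ : Fintype.card α = n) (l : List (α × α)) (_ : (l.map Prod.fst).Nodup)
    (_ : (l.map Prod.snd).Nodup),
    ewensSum θ l = θ ^ closedCycles l * ∏ i ∈ Finset.range (n - l.length), (θ + i) := by
  induction n with
  | zero =>
    intro α _ _ hα l _ _
    have : IsEmpty α := Fintype.card_eq_zero_iff.1 hα
    have hl : l = [] := List.eq_nil_iff_forall_not_mem.2 fun p => isEmptyElim p.1
    subst hl
    simp [ewensSum, closedCycles_nil, orbitCount]
  | succ n ih =>
    intro α _ _ hα l h1 h2
    -- The point to delete is the source of the first pair, or arbitrary if there is no pair.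
    obtain ⟨a, ha⟩ : ∃ a : α, ∀ p ∈ l.head?, p.1 = a := by
      rcases l with - | ⟨p, l⟩
      · have : Nonempty α := Fintype.card_pos_iff.1 (by omega)
        exact ⟨Classical.arbitrary α, by simp⟩
      · exact ⟨p.1, by simp⟩
    let e : α ≃ Option {x // x ≠ a} := (optionSubtypeNe a).symm
    have hea : e a = none := by simp [e]
    have hβ : Fintype.card {x // x ≠ a} = n := by
      have := Fintype.card_congr e
      rw [Fintype.card_option] at this
      omega
    rw [← ewensSum_map θ e, ← closedCycles_map e e.injective _ l rfl,
      ← List.length_map (f := Prod.map e e) (as := l)]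
    have h1' : ((l.map (Prod.map e e)).map Prod.fst).Nodup := by
      rw [List.map_map, Prod.map_fst', ← List.map_map]
      exact h1.map e.injective
    have h2' : ((l.map (Prod.map e e)).map Prod.snd).Nodup := by
      rw [List.map_map, Prod.map_snd', ← List.map_map]
      exact h2.map e.injective
    have hhead : ∀ p ∈ (l.map (Prod.map e e)).head?, p.1 = none := by
      rcases l with - | ⟨p, l⟩
      · simp
      · have := ha p (by simp)
        simp [this, hea]
    generalize l.map (Prod.map e e) = m at h1' h2' hhead ⊢
    rcases m with - | ⟨⟨c, b⟩, m⟩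
    · rw [ewensSum_nil_option, ih _ hβ [] (by simp) (by simp), hβ, closedCycles_nil,
        closedCycles_nil]
      simp [Finset.prod_range_succ, mul_comm]
    · have hc : c = none := hhead (c, b) (by simp)
      subst hc
      have hfst : ∀ q ∈ m, q.1 ≠ none := by
        intro q hq h
        rw [List.map_cons, List.nodup_cons] at h1'
        exact h1'.1 (List.mem_map.2 ⟨q, hq, h⟩)
      have hsnd : ∀ q ∈ m, q.2 ≠ b := by
        intro q hq h
        rw [List.map_cons, List.nodup_cons] at h2'
        exact h2'.1 (List.mem_map.2 ⟨q, hq, h⟩)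
      have hsnd' : ∀ q ∈ m, (if q.2 = none then b else q.2) ≠ none := by
        intro q hq
        split_ifs with hq2
        · intro hb
          exact hsnd q hq (hq2.trans hb.symm)
        · exact hq2
      obtain ⟨m', hm'⟩ : ∃ m' : List ({x // x ≠ a} × {x // x ≠ a}),
          (m.map fun q => (q.1, if q.2 = none then b else q.2)) = m'.map (Prod.map some some) := by
        have : (m.map fun q => (q.1, if q.2 = none then b else q.2)) ∈
            Set.range (List.map (Prod.map some some)) := by
          rw [Set.range_list_map]
          intro q hq
          obtain ⟨z, hz, rfl⟩ := List.mem_map.1 hq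
          obtain ⟨x, hx⟩ := Option.ne_none_iff_exists.1 (hfst z hz)
          obtain ⟨y, hy⟩ := Option.ne_none_iff_exists.1 (hsnd' z hz)
          exact ⟨(x, y), by simp [hx, ← hy]⟩
        obtain ⟨m', h⟩ := this
        exact ⟨m', h.symm⟩
      have hlen : m.length = m'.length := by simpa using congrArg List.length hm'
      have hm1 : (m'.map Prod.fst).Nodup := by
        have : (m'.map Prod.fst).map some = m.map Prod.fst := by
          have := congrArg (List.map Prod.fst) hm'
          simp only [List.map_map] at this ⊢
          exact this.symm
        refine List.Nodup.of_map some ?_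
        rw [this]
        exact (List.nodup_cons.1 h1').2
      have hm2 : (m'.map Prod.snd).Nodup := by
        have : (m'.map Prod.snd).map some =
            (m.map Prod.snd).map fun z => if z = none then b else z := by
          have := congrArg (List.map Prod.snd) hm'
          simp only [List.map_map] at this ⊢
          exact this.symm
        refine List.Nodup.of_map some ?_
        rw [this]
        -- Redirecting `none` to `b` stays injective since `b` is already the target of the head
        -- pair.
        refine List.Nodup.map_on ?_ (List.nodup_cons.1 h2').2
        intro x hx y hy hxy
        have hxb : x ≠ b := by
          rintro rfl
          exact (List.nodup_cons.1 h2').1 hx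
        have hyb : y ≠ b := by
          rintro rfl
          exact (List.nodup_cons.1 h2').1 hy
        split_ifs at hxy with hx0 hy0 hy0
        · rw [hx0, hy0]
        · exact absurd hxy.symm hyb
        · exact absurd hxy hxb
        · exact hxy
      rw [ewensSum_decomposeOption θ b m m' h2' hm', ih _ hβ m' hm1 hm2, closedCycles_cons,
        hm', closedCycles_map some (Option.some_injective _) _ m' rfl, List.length_cons, hlen,
        Nat.add_sub_add_right, pow_add]
      by_cases hb : b = none <;> simp [hb]; ring

end Ewens

/-! ### Joint moments of the elementary variables. -/

section EwensMoments

open Equiv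

/-- `ewensSum` ignores the order of the list, and at `θ = 2` its value determines the exponent
`closedCycles`. -/
theorem closedCycles_perm {α : Type} [Fintype α] [DecidableEq α] {l l' : List (α × α)}
    (h : l.Perm l') (h1 : (l.map Prod.fst).Nodup) (h2 : (l.map Prod.snd).Nodup) :
    closedCycles l = closedCycles l' := by
  have e1 := ewensSum_eq 2 _ α rfl l h1 h2
  have e2 := ewensSum_eq 2 _ α rfl l' ((h.map _).nodup_iff.1 h1) ((h.map _).nodup_iff.1 h2)
  have e3 : ewensSum 2 l = ewensSum 2 l' := by
    simp only [ewensSum, h.mem_iff]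
  rw [e1, e2, h.length_eq] at e3
  have hpos : (0 : ℝ) < ∏ i ∈ Finset.range (Fintype.card α - l'.length), (2 + (i : ℝ)) :=
    Finset.prod_pos fun i _ => by positivity
  have := mul_right_cancel₀ hpos.ne' e3
  exact pow_right_injective₀ (by norm_num) (by norm_num) this

/-- `θ` to the number of cycles closed by a partial injection, and `0` for other relations. -/
noncomputable def pairWeight {α : Type} [DecidableEq α] (θ : ℝ) (S : Finset (α × α)) : ℝ :=
  if Set.InjOn Prod.fst (S : Set (α × α)) ∧ Set.InjOn Prod.snd (S : Set (α × α)) then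
    θ ^ closedCycles S.toList else 0

theorem pairWeight_empty {α : Type} [DecidableEq α] (θ : ℝ) : pairWeight θ (∅ : Finset (α × α)) = 1 := by
  simp [pairWeight, closedCycles_nil]

theorem nodup_map_toList {α γ : Type} {S : Finset α} {f : α → γ}
    (h : Set.InjOn f (S : Set α)) : (S.toList.map f).Nodup :=
  List.Nodup.map_on (fun x hx y hy hxy => h (by simpa using hx) (by simpa using hy) hxy)
    S.nodup_toList

theorem pairWeight_mem {α : Type} [DecidableEq α] (θ : ℝ) (S : Finset (α × α)) :
    pairWeight θ S = 0 ∨ ∃ c ≤ S.card, pairWeight θ S = θ ^ c := by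
  rw [pairWeight]
  split_ifs
  · right
    exact ⟨_, closedCycles_le _ _ (by simp), rfl⟩
  · exact Or.inl rfl

theorem injOn_union_iff {α : Type} [DecidableEq α] {γ : Type} {f : α → γ} {S T : Finset α}
    (h : ∀ p ∈ S, ∀ q ∈ T, f p ≠ f q) :
    Set.InjOn f ((S ∪ T : Finset α) : Set α) ↔ Set.InjOn f (S : Set α) ∧ Set.InjOn f (T : Set α) := by
  constructor
  · intro hi
    exact ⟨hi.mono (by rw [Finset.coe_union]; exact Set.subset_union_left),
      hi.mono (by rw [Finset.coe_union]; exact Set.subset_union_right)⟩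
  · rintro ⟨hS, hT⟩ x hx y hy hxy
    simp only [Finset.coe_union, Set.mem_union, Finset.mem_coe] at hx hy
    rcases hx with hx | hx <;> rcases hy with hy | hy
    · exact hS hx hy hxy
    · exact absurd hxy (h x hx y hy)
    · exact absurd hxy.symm (h y hy x hx)
    · exact hT hx hy hxy

theorem pairWeight_union {α : Type} [Fintype α] [DecidableEq α] (θ : ℝ) {S T : Finset (α × α)}
    (h : ∀ p ∈ S, ∀ q ∈ T, p.1 ≠ q.1 ∧ p.1 ≠ q.2 ∧ p.2 ≠ q.1 ∧ p.2 ≠ q.2) :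
    pairWeight θ (S ∪ T) = pairWeight θ S * pairWeight θ T := by
  have i1 := injOn_union_iff (f := Prod.fst) fun p hp q hq => (h p hp q hq).1
  have i2 := injOn_union_iff (f := Prod.snd) fun p hp q hq => (h p hp q hq).2.2.2
  have hdisj : Disjoint S T := by
    rw [Finset.disjoint_left]
    exact fun p hp hq => (h p hp p hq).1 rfl
  simp only [pairWeight, i1, i2]
  by_cases hS : Set.InjOn Prod.fst (S : Set (α × α)) ∧ Set.InjOn Prod.snd (S : Set (α × α))
  · by_cases hT : Set.InjOn Prod.fst (T : Set (α × α)) ∧ Set.InjOn Prod.snd (T : Set (α × α))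
    · rw [if_pos ⟨⟨hS.1, hT.1⟩, hS.2, hT.2⟩, if_pos hS, if_pos hT, ← pow_add]
      congr 1
      have hp : (S ∪ T).toList.Perm (S.toList ++ T.toList) := by
        refine (List.perm_ext_iff_of_nodup (Finset.nodup_toList _) ?_).2 (by simp)
        refine List.Nodup.append S.nodup_toList T.nodup_toList ?_
        intro p hp hq
        exact Finset.disjoint_left.1 hdisj (by simpa using hp) (by simpa using hq)
      rw [← closedCycles_append _ _ _ rfl (by simpa using h)]
      exact closedCycles_perm hp (nodup_map_toList (i1.2 ⟨hS.1, hT.1⟩))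
        (nodup_map_toList (i2.2 ⟨hS.2, hT.2⟩))
    · rw [if_neg hT, mul_zero, if_neg]
      exact fun hc => hT ⟨hc.1.2, hc.2.2⟩
  · rw [if_neg hS, zero_mul, if_neg]
    exact fun hc => hS ⟨hc.1.1, hc.2.1⟩

theorem inverseMoment_eq_div {θ : ℝ} (hθ : 0 < θ) {N k : ℕ} (hk : k ≤ N) :
    (∏ i ∈ Finset.range (N - k), (θ + i)) / ∏ i ∈ Finset.range N, (θ + i) =
      inverseMoment θ N k := by
  have hpos : ∀ n : ℕ, ∏ i ∈ Finset.range n, (θ + (i : ℝ)) ≠ 0 := fun n =>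
    (Finset.prod_pos fun i _ => by positivity).ne'
  induction k with
  | zero => rw [Nat.sub_zero, div_self (hpos N), inverseMoment_zero]
  | succ k ih =>
    have e : N - k = N - (k + 1) + 1 := by omega
    have ih' := ih (by omega)
    rw [e, Finset.prod_range_succ] at ih'
    have hc : ((N - (k + 1) : ℕ) : ℝ) = N - (k + 1) := by
      rw [Nat.cast_sub hk]; push_cast; ring
    have hne : θ + ((N - (k + 1) : ℕ) : ℝ) ≠ 0 := by positivity
    rw [inverseMoment_succ, ← ih']
    have e2 : (N : ℝ) + θ - (k + 1) = θ + ((N - (k + 1) : ℕ) : ℝ) := by rw [hc]; ring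
    rw [e2]
    field_simp

/-- Joint moments of the elementary variables under the Ewens distribution. -/
theorem ewens_moment {θ : ℝ} (hθ : 0 < θ) (N : ℕ) (S : Finset (Fin N × Fin N)) :
    ∑ σ : Perm (Fin N), θ ^ numCycles σ / (∏ k ∈ Finset.range N, (θ + k)) *
      (if ∀ p ∈ S, σ p.1 = p.2 then 1 else 0) = pairWeight θ S * inverseMoment θ N S.card := by
  rw [pairWeight]
  split_ifs with h
  · have h1 := nodup_map_toList h.1
    have h2 := nodup_map_toList h.2
    have hcard : S.card ≤ N := by
      have := h1.length_le_card
      simpa using this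
    rw [← inverseMoment_eq_div hθ hcard, mul_div_assoc']
    have := ewensSum_eq θ N (Fin N) (by simp) S.toList h1 h2
    rw [Finset.length_toList] at this
    have e : ∀ σ : Perm (Fin N), θ ^ numCycles σ / (∏ k ∈ Finset.range N, (θ + k)) *
        (if ∀ p ∈ S, σ p.1 = p.2 then 1 else 0) =
        (if ∀ p ∈ S.toList, σ p.1 = p.2 then θ ^ orbitCount σ else 0) /
          (∏ k ∈ Finset.range N, (θ + (k : ℝ))) := by
      intro σ
      simp only [Finset.mem_toList, numCycles, card_parts_partition]
      split_ifs <;> simp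
    rw [Finset.sum_congr rfl fun σ _ => e σ, ← Finset.sum_div]
    congr 1
  -- No permutation satisfies a relation that is not a partial injection.
  · rw [zero_mul]
    refine Finset.sum_eq_zero fun σ _ => ?_
    rw [if_neg, mul_zero]
    intro hσ
    refine h ⟨fun p hp q hq hpq => ?_, fun p hp q hq hpq => ?_⟩
    · exact Prod.ext hpq (by rw [← hσ p hp, ← hσ q hq, hpq])
    · exact Prod.ext (σ.injective (by rw [hσ p hp, hσ q hq, hpq])) hpq

theorem integral_ewensMeasure {θ : ℝ} (hθ : 0 < θ) (N : ℕ) (φ : Perm (Fin N) → ℝ) :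
    ∫ σ, φ σ ∂(ewensMeasure θ N) =
      ∑ σ, θ ^ numCycles σ / (∏ k ∈ Finset.range N, (θ + k)) * φ σ := by
  rw [ewensMeasure, integral_finsetSum_measure]
  · refine Finset.sum_congr rfl fun σ _ => ?_
    rw [integral_smul_measure, integral_dirac, ENNReal.toReal_ofReal, smul_eq_mul]
    exact div_nonneg (by positivity) (Finset.prod_nonneg fun i _ => by positivity)
  · intro σ _
    exact Integrable.smul_measure (integrable_dirac (by simp)) ENNReal.ofReal_ne_top

end EwensMoments

/-! ### Uniformity of the constant. -/

section Uniformity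

open Filter

/-- `C` is quantified before the hypotheses so that it is a function of the raw data, to be
maximized over a finite type. -/
theorem cumulant_bound {θ : ℝ} {ι β : Type*} [Fintype ι] [DecidableEq ι] [DecidableEq β]
    (comp : ι → β) (f : Finset ι → ℝ) (K : Finset ι → ℕ) (a : ι) :
    ∃ C : ℝ, f ∅ = 1 → K ∅ = 0 → (∀ S Δ, S ⊆ Δ → K Δ ≤ K S + K (Δ \ S)) →
      (∀ (d : β) (Δ : Finset ι),
        f Δ = f (Δ.filter (comp · = d)) * f (Δ.filter (comp · ≠ d))) →
      (∀ (d : β) (Δ : Finset ι),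
        K Δ = K (Δ.filter (comp · = d)) + K (Δ.filter (comp · ≠ d))) →
      ∀ (N : ℕ) (M κ : SetSeries ι ℝ), 1 ≤ N → (∀ Δ, M Δ = f Δ * inverseMoment θ N (K Δ)) →
        SetSeries.part a M = M * SetSeries.part a κ →
        |κ Finset.univ| ≤
          C * ((N : ℝ)⁻¹) ^ (K Finset.univ + ((Finset.univ.image comp).card - 1)) := by
  by_cases h : f ∅ = 1 ∧ K ∅ = 0 ∧ (∀ S Δ, S ⊆ Δ → K Δ ≤ K S + K (Δ \ S)) ∧
      (∀ (d : β) (Δ : Finset ι),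
        f Δ = f (Δ.filter (comp · = d)) * f (Δ.filter (comp · ≠ d))) ∧
      (∀ (d : β) (Δ : Finset ι),
        K Δ = K (Δ.filter (comp · = d)) + K (Δ.filter (comp · ≠ d)))
  · obtain ⟨hf0, hK0, hK, hfmul, hKadd⟩ := h
    obtain ⟨M, hM⟩ : ∃ M : ℕ → SetSeries ι ℝ, ∀ N Δ, M N Δ = f Δ * inverseMoment θ N (K Δ) :=
      ⟨fun _ _ => _, fun _ _ => rfl⟩
    have hM0 : ∀ N, M N ∅ = 1 := fun N => by rw [hM, hf0, hK0, inverseMoment_zero, one_mul]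
    choose κ _ hκ using fun N => SetSeries.exists_log (hM0 N)
    have hpart := fun N => SetSeries.part_log (hM0 N) (hκ N) a
    -- The asymptotic bound extends, with a larger constant, to every `N` where the comparison
    -- sequence is nonzero, in particular to all `N ≥ 1`.
    obtain ⟨C, -, hC⟩ := Asymptotics.bound_of_isBigO_nat_atTop
      (SetSeries.cumulant_isBigO θ comp f K hf0 hK0 hK hfmul hKadd a M κ hM hpart)
    refine ⟨C, fun _ _ _ _ _ N M' κ' hN hM' hκ' => ?_⟩
    have hMM : M' = M N := by
      ext Δ
      rw [hM, hM']
    have hN' : (0 : ℝ) < N := by exact_mod_cast hN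
    -- `M N` is invertible, so it determines `part a κ'`, which agrees with `κ'` on sets containing
    -- `a`.
    have hκκ : κ' Finset.univ = κ N Finset.univ := by
      have h1 : M N * SetSeries.part a κ' = M N * SetSeries.part a (κ N) := by
        rw [← hpart, ← hMM, hκ']
      have h2 := congrFun ((SetSeries.isUnit_of_apply_empty (hM0 N)).mul_left_cancel h1)
        Finset.univ
      simpa [SetSeries.part_apply] using h2
    have := hC (x := N) (by positivity)
    rw [Real.norm_of_nonneg (by positivity : (0 : ℝ) ≤ ((N : ℝ)⁻¹) ^ _)] at this
    rw [hκκ]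
    exact this
  · refine ⟨0, fun h1 h2 h3 h4 h5 => absurd ⟨h1, h2, h3, h4, h5⟩ h⟩

/-- The possible values of `pairWeight` on at most `r` pairs. -/
def pairWeightValues (θ : ℝ) (r : ℕ) : Set ℝ := insert 0 ((θ ^ ·) '' Set.Iic r)

theorem finite_pairWeightValues (θ : ℝ) (r : ℕ) : (pairWeightValues θ r).Finite :=
  ((Set.finite_Iic r).image _).insert 0

theorem cumulant_uniform_bound (θ : ℝ) (r : ℕ) : ∃ C : ℝ, ∀ (ℓ : ℕ), ℓ ≤ r →
    ∀ (comp : Fin ℓ → Fin r) (f : Finset (Fin ℓ) → ℝ) (K : Finset (Fin ℓ) → ℕ) (a : Fin ℓ),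
      (∀ Δ, f Δ ∈ pairWeightValues θ r) → (∀ Δ, K Δ ≤ r) →
      f ∅ = 1 → K ∅ = 0 → (∀ S Δ, S ⊆ Δ → K Δ ≤ K S + K (Δ \ S)) →
      (∀ (d : Fin r) (Δ : Finset (Fin ℓ)),
        f Δ = f (Δ.filter (comp · = d)) * f (Δ.filter (comp · ≠ d))) →
      (∀ (d : Fin r) (Δ : Finset (Fin ℓ)),
        K Δ = K (Δ.filter (comp · = d)) + K (Δ.filter (comp · ≠ d))) →
      ∀ (N : ℕ) (M κ : SetSeries (Fin ℓ) ℝ), 1 ≤ N →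
        (∀ Δ, M Δ = f Δ * inverseMoment θ N (K Δ)) →
        SetSeries.part a M = M * SetSeries.part a κ →
        |κ Finset.univ| ≤
          C * ((N : ℝ)⁻¹) ^ (K Finset.univ + ((Finset.univ.image comp).card - 1)) := by
  have : Finite (pairWeightValues θ r) := (finite_pairWeightValues θ r).to_subtype
  let Config : Type := Σ ℓ : Fin (r + 1), (Fin ℓ → Fin r) ×
    (Finset (Fin ℓ) → pairWeightValues θ r) × (Finset (Fin ℓ) → Fin (r + 1)) × Fin ℓ
  choose C hC using fun c : Config =>
    cumulant_bound (θ := θ) c.2.1 (fun Δ => (c.2.2.1 Δ : ℝ)) (fun Δ => (c.2.2.2.1 Δ : ℕ)) c.2.2.2.2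
  obtain ⟨D, hD⟩ := Finite.exists_le C
  refine ⟨D, fun ℓ hℓ comp f K a hf hK h1 h2 h3 h4 h5 N M κ hN hM hκ => ?_⟩
  let c : Config := ⟨⟨ℓ, by omega⟩, comp, fun Δ => ⟨f Δ, hf Δ⟩,
    fun Δ => ⟨K Δ, Nat.lt_succ_of_le (hK Δ)⟩, a⟩
  exact (hC c h1 h2 h3 h4 h5 N M κ hN hM hκ).trans
    (mul_le_mul_of_nonneg_right (hD c) (by positivity))

end Uniformity

/-! ### Moments and cumulants of products over parts. -/

section Assembly

/-- The pairs `(i_j, s_j)` for `j` in the parts with label in `Δ`. -/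
def pairsOf {r N ℓ : ℕ} (A : Fin ℓ → Finset (Fin r)) (i s : Fin r → Fin N) (Δ : Finset (Fin ℓ)) :
    Finset (Fin N × Fin N) :=
  Δ.biUnion fun h => (A h).image fun j => (i j, s j)

theorem mem_pairsOf {r N ℓ : ℕ} {A : Fin ℓ → Finset (Fin r)} {i s : Fin r → Fin N}
    {Δ : Finset (Fin ℓ)} {p : Fin N × Fin N} :
    p ∈ pairsOf A i s Δ ↔ ∃ h ∈ Δ, ∃ j ∈ A h, (i j, s j) = p := by
  simp [pairsOf]

theorem pairsOf_union {r N ℓ : ℕ} (A : Fin ℓ → Finset (Fin r)) (i s : Fin r → Fin N)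
    (Δ Γ : Finset (Fin ℓ)) : pairsOf A i s (Δ ∪ Γ) = pairsOf A i s Δ ∪ pairsOf A i s Γ :=
  Finset.union_biUnion

theorem card_pairsOf_le {r N ℓ : ℕ} (A : Fin ℓ → Finset (Fin r)) (i s : Fin r → Fin N)
    (Δ : Finset (Fin ℓ)) : (pairsOf A i s Δ).card ≤ r := by
  have : pairsOf A i s Δ ⊆ Finset.univ.image fun j => (i j, s j) := by
    intro p hp
    obtain ⟨h, _, j, _, rfl⟩ := mem_pairsOf.1 hp
    exact Finset.mem_image_of_mem _ (Finset.mem_univ j)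
  refine (Finset.card_le_card this).trans (Finset.card_image_le.trans ?_)
  simp

/-- Adjacency in `graphG1` is equality of pairs at distinct indices, so its components are the
fibres of `j ↦ (i j, s j)`. -/
theorem numParts_graphG1 {r N : ℕ} (i s : Fin r → Fin N) :
    numParts (connSetoid (graphG1 i s)) = (Finset.univ.image fun j => (i j, s j)).card := by
  have h : connSetoid (graphG1 i s) = Setoid.ker fun j => (i j, s j) := by
    ext j h
    constructor
    · intro hr
      have hr' : (graphG1 i s).Reachable j h := hr
      obtain ⟨w⟩ := hr'
      induction w with
      | nil => rfl
      | cons hadj _ ih =>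
        exact (Prod.ext hadj.2.1 hadj.2.2).trans (ih (SimpleGraph.Walk.reachable ‹_›))
    · intro hk
      show (graphG1 i s).Reachable j h
      by_cases hjh : j = h
      · exact hjh ▸ SimpleGraph.Reachable.refl _
      · have hk' : (i j, s j) = (i h, s h) := hk
        exact SimpleGraph.Adj.reachable
          ⟨hjh, congrArg Prod.fst hk', congrArg Prod.snd hk'⟩
  rw [numParts, h, Nat.card_congr (Setoid.quotientKerEquivRange _), Nat.card_eq_fintype_card,
    ← Set.toFinset_card, Set.toFinset_range]

/-- Joint moments and cumulants of products of elementary variables. -/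
theorem exists_jet {θ : ℝ} (hθ : 0 < θ) {r N ℓ : ℕ} (A : Fin ℓ → Finset (Fin r))
    (i s : Fin r → Fin N) {Ω : Type*} [MeasurableSpace Ω] (P : Measure Ω)
    (σ : Ω → Equiv.Perm (Fin N)) (hσ : ProbabilityTheory.HasLaw σ (ewensMeasure θ N) P) :
    ∃ M κ : SetSeries (Fin ℓ) ℝ,
      (∀ Δ, M Δ = pairWeight θ (pairsOf A i s Δ) *
        inverseMoment θ N (pairsOf A i s Δ).card) ∧
      (∀ a, SetSeries.part a M = M * SetSeries.part a κ) ∧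
      κ Finset.univ = jointCumulant P
        (fun (h : Fin ℓ) (ω : Ω) => ∏ j ∈ A h, elemVar σ (i j) (s j) ω) := by
  let w : Equiv.Perm (Fin N) → ℝ :=
    fun ρ => θ ^ numCycles ρ / (∏ k ∈ Finset.range N, (θ + k))
  let Y : Fin ℓ → Equiv.Perm (Fin N) → ℝ :=
    fun h ρ => ∏ j ∈ A h, if ρ (i j) = s j then 1 else 0
  have hF := contDiff_expSum w Y
  have hpos : ∀ t, 0 < expSum w Y t := by
    intro t
    refine Finset.sum_pos (fun ρ _ => ?_) Finset.univ_nonempty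
    refine mul_pos (div_pos (by positivity) (Finset.prod_pos fun k _ => by positivity))
      (Real.exp_pos _)
  refine ⟨jet (expSum w Y), jet fun t => Real.log (expSum w Y t), fun Δ => ?_,
    fun a => part_jet_of_log hF hpos a, ?_⟩
  · rw [jet_expSum, ← ewens_moment hθ]
    refine Finset.sum_congr rfl fun ρ _ => ?_
    congr 1
    simp only [Y, Finset.prod_boole]
    have hiff : (∀ p ∈ pairsOf A i s Δ, ρ p.1 = p.2) ↔ ∀ a ∈ Δ, ∀ j ∈ A a, ρ (i j) = s j := by
      simp only [mem_pairsOf]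
      constructor
      · intro h a ha j hj
        exact h _ ⟨a, ha, j, hj, rfl⟩
      · rintro h _ ⟨a, ha, j, hj, rfl⟩
        exact h a ha j hj
    by_cases h : ∀ a ∈ Δ, ∀ j ∈ A a, ρ (i j) = s j
    · rw [if_pos (hiff.2 h)]
      exact Finset.prod_eq_one fun a ha => if_pos (h a ha)
    · rw [if_neg (fun hc => h (hiff.1 hc))]
      push Not at h
      obtain ⟨a, ha, j, hj, hne⟩ := h
      exact Finset.prod_eq_zero ha (if_neg fun hc => hne (hc j hj))
  · rw [jet_univ (hF.log fun t => (hpos t).ne'), jointCumulant]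
    congr 2
    funext t
    congr 1
    rw [expSum, ← integral_ewensMeasure hθ N fun ρ => Real.exp (∑ h, t h * Y h ρ), ← hσ.map_eq,
      integral_map hσ.aemeasurable (Measurable.of_discrete).aestronglyMeasurable]
    rfl

end Assembly

/-! ### The cumulant bound for Ewens permutations. -/

theorem theorem1p4 (θ : ℝ) (hθ : 0 < θ) (r : ℕ) (hr : 1 ≤ r) :
    ∃ C : ℝ, ∀ (ℓ : ℕ) (τ : Finpartition (Finset.univ : Finset (Fin r)))
      (e : Fin ℓ ≃ {A : Finset (Fin r) // A ∈ τ.parts})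
      (N : ℕ) (_ : 1 ≤ N) (i s : Fin r → Fin N)
      (Ω : Type*) [MeasurableSpace Ω] (P : Measure Ω) [IsProbabilityMeasure P]
      (σ : Ω → Equiv.Perm (Fin N)) (_ : ProbabilityTheory.HasLaw σ (ewensMeasure θ N) P),
      |jointCumulant P
          (fun (h : Fin ℓ) (ω : Ω) => ∏ j ∈ (e h).1, elemVar σ (i j) (s j) ω)| ≤
        C * (N : ℝ) ^ (-(numParts (connSetoid (graphG1 i s)) : ℤ)
          - (numParts (connSetoid (graphG2 i s) ⊔ partitionSetoid τ) : ℤ) + 1) := by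
  obtain ⟨C, hC⟩ := cumulant_uniform_bound θ r
  refine ⟨C, fun ℓ τ e N hN i s Ω _ P _ σ hσ => ?_⟩
  let A : Fin ℓ → Finset (Fin r) := fun h => (e h).1
  let Q : Setoid (Fin r) := connSetoid (graphG2 i s) ⊔ partitionSetoid τ
  have hA : ∀ h, (A h).Nonempty := fun h => τ.nonempty_of_mem_parts (e h).2
  have hcover : ∀ j, ∃ h, j ∈ A h := fun j =>
    ⟨e.symm ⟨τ.part j, τ.part_mem.2 (Finset.mem_univ j)⟩, by
      simp [A, τ.mem_part (Finset.mem_univ j)]⟩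
  choose b hb using hA
  -- Blocks of `Q` are named by representatives in `Fin r`, so that the labels live in a type
  -- depending on `r` alone.
  let comp : Fin ℓ → Fin r := fun h => (Quotient.mk Q (b h)).out
  have hcomp : ∀ h, ∀ j ∈ A h, comp h = (Quotient.mk Q j).out := by
    intro h j hj
    refine congrArg Quotient.out (Quotient.sound (s := Q) ?_)
    have h1 : partitionSetoid τ ≤ Q := le_sup_right
    refine h1 ?_
    show τ.part (b h) = τ.part j
    rw [τ.part_eq_of_mem (e h).2 (hb h), τ.part_eq_of_mem (e h).2 hj]
  have hℓ : ℓ ≤ r := by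
    have h1 := Fintype.card_congr e
    have h2 := τ.card_parts_le_card
    simp at h1 h2
    omega
  have hsplit : ∀ (d : Fin r) (Δ : Finset (Fin ℓ)), pairsOf A i s Δ =
      pairsOf A i s (Δ.filter (comp · = d)) ∪ pairsOf A i s (Δ.filter (comp · ≠ d)) := by
    intro d Δ
    rw [← pairsOf_union, Finset.filter_union_filter_not_eq]
  -- A shared point would give an edge of `graphG2` or a common index, and so the same block of `Q`.
  have hsep : ∀ (d : Fin r) (Δ : Finset (Fin ℓ)),
      ∀ p ∈ pairsOf A i s (Δ.filter (comp · = d)),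
      ∀ q ∈ pairsOf A i s (Δ.filter (comp · ≠ d)),
      p.1 ≠ q.1 ∧ p.1 ≠ q.2 ∧ p.2 ≠ q.1 ∧ p.2 ≠ q.2 := by
    intro d Δ p hp q hq
    obtain ⟨h, hh, j, hj, rfl⟩ := mem_pairsOf.1 hp
    obtain ⟨h', hh', j', hj', rfl⟩ := mem_pairsOf.1 hq
    have hne : ¬ (({i j, s j} : Set (Fin N)) ∩ {i j', s j'}).Nonempty := by
      intro hint
      refine (Finset.mem_filter.1 hh').2 ?_
      rw [← (Finset.mem_filter.1 hh).2, hcomp h j hj, hcomp h' j' hj']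
      refine congrArg Quotient.out (Quotient.sound (s := Q) ?_)
      by_cases hjj : j' = j
      · exact hjj ▸ Q.refl _
      · have h1 : connSetoid (graphG2 i s) ≤ Q := le_sup_left
        refine h1 (SimpleGraph.Adj.reachable ⟨hjj, ?_⟩)
        rwa [Set.inter_comm]
    exact ⟨fun hc => hne ⟨i j, Or.inl rfl, Or.inl hc⟩, fun hc => hne ⟨i j, Or.inl rfl, Or.inr hc⟩,
      fun hc => hne ⟨s j, Or.inr rfl, Or.inl hc⟩, fun hc => hne ⟨s j, Or.inr rfl, Or.inr hc⟩⟩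
  have hdisj : ∀ (d : Fin r) (Δ : Finset (Fin ℓ)),
      Disjoint (pairsOf A i s (Δ.filter (comp · = d)))
        (pairsOf A i s (Δ.filter (comp · ≠ d))) := by
    intro d Δ
    rw [Finset.disjoint_left]
    exact fun p hp hq => (hsep d Δ p hp p hq).1 rfl
  obtain ⟨a, -⟩ := hcover ⟨0, hr⟩
  obtain ⟨M, κ, hM, hκ, hjoint⟩ := exists_jet hθ A i s P σ hσ
  have hmain := hC ℓ hℓ comp (fun Δ => pairWeight θ (pairsOf A i s Δ))
    (fun Δ => (pairsOf A i s Δ).card) a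
    (fun Δ => by
      rcases pairWeight_mem θ (pairsOf A i s Δ) with h | ⟨c, hc, h⟩
      · exact Or.inl h
      · exact Or.inr ⟨c, hc.trans (card_pairsOf_le A i s Δ), h.symm⟩)
    (card_pairsOf_le A i s) (by simp [pairsOf, pairWeight_empty]) (by simp [pairsOf])
    (fun S Δ hS => by
      conv_lhs => rw [← Finset.union_sdiff_of_subset hS, pairsOf_union]
      exact Finset.card_union_le _ _)
    (fun d Δ => by
      conv_lhs => rw [hsplit d Δ]
      exact pairWeight_union θ (hsep d Δ))
    (fun d Δ => by
      conv_lhs => rw [hsplit d Δ]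
      exact Finset.card_union_of_disjoint (hdisj d Δ))
    N M κ hN hM (hκ a)
  rw [hjoint] at hmain
  have hK : (pairsOf A i s Finset.univ).card = numParts (connSetoid (graphG1 i s)) := by
    rw [numParts_graphG1]
    congr 1
    ext p
    simp only [mem_pairsOf, Finset.mem_univ, true_and, Finset.mem_image]
    constructor
    · rintro ⟨h, j, _, hp⟩
      exact ⟨j, hp⟩
    · rintro ⟨j, hp⟩
      obtain ⟨h, hj⟩ := hcover j
      exact ⟨h, j, hj, hp⟩
  have hm : (Finset.univ.image comp).card = numParts Q := by
    classical
    have h1 : Finset.univ.image comp = (Finset.univ : Finset (Quotient Q)).image Quotient.out := by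
      ext x
      simp only [Finset.mem_image, Finset.mem_univ, true_and]
      constructor
      · rintro ⟨h, rfl⟩
        exact ⟨_, rfl⟩
      · rintro ⟨q, rfl⟩
        induction q using Quotient.inductionOn with
        | _ j =>
          obtain ⟨h, hj⟩ := hcover j
          exact ⟨h, hcomp h j hj⟩
    rw [h1, Finset.card_image_of_injective _ Quotient.out_injective, numParts,
      Nat.card_eq_fintype_card, Finset.card_univ]
  have hm1 : 1 ≤ (Finset.univ.image comp).card :=
    Finset.card_pos.2 ⟨comp a, Finset.mem_image_of_mem _ (Finset.mem_univ a)⟩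
  refine hmain.trans (le_of_eq ?_)
  congr 1
  rw [hK, ← zpow_natCast, inv_zpow']
  congr 1
  rw [← hm]
  push_cast [Nat.cast_sub hm1]
  ring
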